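/- Let $K/k$ be a finite separable extension of fields. An algebraic scheme over a field $F$ is a separated scheme of finite type over $\operatorname{Spec} F$; an algebraic variety over $F$ is a geometrically reduced algebraic scheme over $F$; it is quasi-projective if it admits an $F$-immersion (as a locally closed subscheme) into some $\mathbb{P}^n_F$. For a field homomorphism $i\colon F\to L$ and an $F$-scheme $X$, write $iX=X\times_{\operatorname{Spec}F,\,i}\operatorname{Spec}L$ (written $X_L$ when $i$ is understood), and similarly for morphisms; identify $j(iX)$ with $(j\circ i)X$. **Proposition 7.1.** Let $V$ be a quasi-projective algebraic variety over $K$. Then the $K/k$-Weil restriction of $V$ exists: there are an algebraic scheme $V_*$ over $k$ and a $K$-morphism $\varphi\colon V_{*K}\to V$ such that, for every algebraic scheme $T$ over $k$ and every $K$-morphism $\varphi'\colon T_K\to V$, there is a unique $k$-morphism $\psi\colon T\to V_*$ with $\varphi\circ\psi_K=\varphi'$. Moreover, $(V_*,\varphi)$ is obtained by Galois descent from the product of the conjugates of $V$, in the following sense. Let $\Omega$ be any (possibly infinite) Galois extension of $k$ over which the minimal polynomial over $k$ of every element of $K$ splits. Let $V'=\prod_{\tau}\tau V$, the product over $\operatorname{Spec}\Omega$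 indexed by the $k$-homomorphisms $\tau\colon K\to\Omega$, with projections $\pi_\tau\colon V'\to\tau V$. For $\sigma\in\operatorname{Gal}(\Omega/k)$ let $\varphi_\sigma\colon\sigma V'\to V'$ be the morphism that acts on the factor $\sigma(\tau V)$ as the canonical isomorphism $\sigma(\tau V)\simeq(\sigma\tau)V$, i.e. $\pi_{\sigma\tau}\circ\varphi_\sigma$ is $\sigma\pi_\tau$ followed by this isomorphism. Then the $\varphi_\sigma$ are isomorphisms with $\varphi_\sigma\circ\sigma\varphi_\tau=\varphi_{\sigma\tau}$ for all $\sigma,\tau\in\operatorname{Gal}(\Omega/k)$, and there is an $\Omega$-isomorphism $\varphi_*\colon V'\to V_{*\Omega}$ such that $\varphi_\sigma=\varphi_*^{-1}\circ\sigma\varphi_*$ for all $\sigma\in\operatorname{Gal}(\Omega/k)$ (where $\sigma(V_{*\Omega})=V_{*\Omega}$) and such that, for every $\tau\colon K\to\Omega$ over $k$, one has $\pi_\tau\circ\varphi_*^{-1}=\tau\varphi$ (where $\tau(V_{*K})=V_{*\Omega}$). -/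

import Mathlib

open CategoryTheory CategoryTheory.Limits AlgebraicGeometry

universe u

namespace WeilRes

noncomputable section

/-- Base change `iV = V ×_{Spec F} Spec L` of `F`-schemes along a homomorphism of fields
`i : F → L`, as a functor; on morphisms it is `α ↦ iα`. -/
abbrev baseChange {F L : Type u} [Field F] [Field L] (i : F →+* L) :
    Over (Spec (CommRingCat.of F)) ⥤ Over (Spec (CommRingCat.of L)) :=
  Over.pullback (Spec.map (CommRingCat.ofHom i))

/-- The canonical isomorphism `j(iV) ≅ (j ∘ i)V`. It is the one compatible with the
projections to `V` and to `Spec M` on both sides. -/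
def baseChangeComp {F L M : Type u} [Field F] [Field L] [Field M]
    (i : F →+* L) (j : L →+* M) (l : F →+* M) (h : j.comp i = l)
    (V : Over (Spec (CommRingCat.of F))) :
    (baseChange j).obj ((baseChange i).obj V) ≅ (baseChange l).obj V :=
  Over.isoMk
    (pullbackLeftPullbackSndIso V.hom (Spec.map (CommRingCat.ofHom i))
        (Spec.map (CommRingCat.ofHom j)) ≪≫
      pullback.congrHom rfl (by rw [← h, CommRingCat.ofHom_comp, Spec.map_comp]))
    (by
      change ((pullbackLeftPullbackSndIso _ _ _).hom ≫ (pullback.congrHom _ _).hom) ≫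
        pullback.snd _ _ = pullback.snd _ _
      rw [Category.assoc, pullback.congrHom_hom]
      erw [pullback.lift_snd]
      rw [Category.comp_id, pullbackLeftPullbackSndIso_hom_snd])

lemma baseChangeComp_hom_left_fst {F L M : Type u} [Field F] [Field L] [Field M]
    (i : F →+* L) (j : L →+* M) (l : F →+* M) (h : j.comp i = l)
    (V : Over (Spec (CommRingCat.of F))) :
    (baseChangeComp i j l h V).hom.left ≫ pullback.fst V.hom (Spec.map (CommRingCat.ofHom l)) =
      pullback.fst (pullback.snd V.hom (Spec.map (CommRingCat.ofHom i)))
          (Spec.map (CommRingCat.ofHom j)) ≫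
        pullback.fst V.hom (Spec.map (CommRingCat.ofHom i)) := by
  change ((pullbackLeftPullbackSndIso _ _ _).hom ≫ (pullback.congrHom _ _).hom) ≫
    pullback.fst _ _ = _
  rw [Category.assoc, pullback.congrHom_hom]
  erw [pullback.lift_fst]
  rw [Category.comp_id, pullbackLeftPullbackSndIso_hom_fst]

/-- An algebraic scheme over a field `F`: a separated scheme of finite type over `Spec F`. -/
structure IsAlgebraicScheme {F : Type u} [Field F] (V : Over (Spec (CommRingCat.of F))) :
    Prop where
  isSeparated : IsSeparated V.hom
  locallyOfFiniteType : LocallyOfFiniteType V.hom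
  quasiCompact : QuasiCompact V.hom

/-- An algebraic variety over `F`: a geometrically reduced algebraic scheme. -/
structure IsAlgebraicVariety {F : Type u} [Field F] (V : Over (Spec (CommRingCat.of F))) :
    Prop extends IsAlgebraicScheme V where
  geometricallyReduced : GeometricallyReduced V.hom

section

attribute [local instance] MvPolynomial.gradedAlgebra

/-- Projective space `ℙⁿ = Proj F[X₀, …, Xₙ]` over a field `F`. -/
def projectiveSpace (F : Type u) [Field F] (n : ℕ) : Over (Spec (CommRingCat.of F)) :=
  Over.mk
    (Proj.toSpecZero (MvPolynomial.homogeneousSubmodule (Fin (n + 1)) F) ≫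
      Spec.map (CommRingCat.ofHom
        (algebraMap F (MvPolynomial.homogeneousSubmodule (Fin (n + 1)) F 0))))

end

/-- `V` is quasi-projective over `F`: it is isomorphic, over `F`, to a (locally closed)
subscheme of some projective space `ℙⁿ`. -/
def IsQuasiProjective {F : Type u} [Field F] (V : Over (Spec (CommRingCat.of F))) : Prop :=
  ∃ (n : ℕ) (e : V ⟶ projectiveSpace F n), IsImmersion e.left

section WeilRestriction

variable {k K : Type u} [Field k] [Field K] [Algebra k K]

/-- `(W, φ)`, with `φ : W_K → V`, is the `K/k`-Weil restriction of the `K`-scheme `V`: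
`W` is an algebraic scheme over `k` and, for every algebraic scheme `T` over `k`, each
`K`-morphism `T_K → V` is `φ ∘ ψ_K` for a unique `k`-morphism `ψ : T → W`. -/
structure IsWeilRestriction (V : Over (Spec (CommRingCat.of K)))
    (W : Over (Spec (CommRingCat.of k))) (φ : (baseChange (algebraMap k K)).obj W ⟶ V) :
    Prop where
  isAlgebraicScheme : IsAlgebraicScheme W
  existsUnique : ∀ T : Over (Spec (CommRingCat.of k)), IsAlgebraicScheme T →
    ∀ φ' : (baseChange (algebraMap k K)).obj T ⟶ V,
      ∃! ψ : T ⟶ W, (baseChange (algebraMap k K)).map ψ ≫ φ = φ'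

end WeilRestriction

section Descent

variable {k Ω : Type u} [Field k] [Field Ω] [Algebra k Ω]

/-- An automorphism of `Ω/k` as a ring homomorphism. -/
abbrev galHom (σ : Ω ≃ₐ[k] Ω) : Ω →+* Ω := (σ : Ω →ₐ[k] Ω).toRingHom

/-- A family `φ σ : σV → V`, for `σ ∈ Aut(Ω/k)`, is an `Ω/k`-descent system: the `φ σ` are
isomorphisms and `φ σ ∘ σ(φ τ) = φ (σ τ)`, where `σ(τV)` is identified with `(στ)V`. -/
structure IsDescentSystem (V : Over (Spec (CommRingCat.of Ω)))
    (φ : ∀ σ : Ω ≃ₐ[k] Ω, (baseChange (galHom σ)).obj V ⟶ V) : Prop where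
  isIso : ∀ σ, IsIso (φ σ)
  cocycle : ∀ σ τ : Ω ≃ₐ[k] Ω, (baseChange (galHom σ)).map (φ τ) ≫ φ σ =
    (baseChangeComp (galHom τ) (galHom σ) (galHom (σ * τ)) rfl V).hom ≫ φ (σ * τ)

/-- The model `(V₀, m)` of `V` over `k`, with `m : V ≅ V₀_Ω`, splits the family `φ`: one has
`φ σ = m⁻¹ ∘ σm` for all `σ`, where `σ(V₀_Ω)` is identified with `V₀_Ω`. -/
def IsSplitBy (V : Over (Spec (CommRingCat.of Ω)))
    (φ : ∀ σ : Ω ≃ₐ[k] Ω, (baseChange (galHom σ)).obj V ⟶ V)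
    (V₀ : Over (Spec (CommRingCat.of k))) (m : V ≅ (baseChange (algebraMap k Ω)).obj V₀) :
    Prop :=
  ∀ σ : Ω ≃ₐ[k] Ω, φ σ = (baseChange (galHom σ)).map m.hom ≫
    (baseChangeComp (algebraMap k Ω) (galHom σ) (algebraMap k Ω)
      (RingHom.ext fun x => σ.commutes x) V₀).hom ≫ m.inv

end Descent

section Conjugates

variable {k K Ω : Type u} [Field k] [Field K] [Field Ω] [Algebra k K] [Algebra k Ω]

instance (F : Type u) [Field F] : HasFiniteProducts (Over (Spec (CommRingCat.of F))) :=
  Over.ConstructProducts.over_finiteProducts_of_finiteWidePullbacks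

variable [FiniteDimensional k K]

/-- The product `∏ τV` over `Spec Ω` of the conjugates of `V`, over all `k`-homomorphisms
`τ : K → Ω`. -/
def conjProd (k Ω : Type u) [Field k] [Field Ω] [Algebra k K] [Algebra k Ω]
    [FiniteDimensional k K] (V : Over (Spec (CommRingCat.of K))) :
    Over (Spec (CommRingCat.of Ω)) :=
  ∏ᶜ fun τ : K →ₐ[k] Ω => (baseChange τ.toRingHom).obj V

/-- The projection `∏ τV → τV`. -/
def conjProdπ (V : Over (Spec (CommRingCat.of K))) (τ : K →ₐ[k] Ω) :
    conjProd k Ω V ⟶ (baseChange τ.toRingHom).obj V :=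
  Pi.π (fun τ : K →ₐ[k] Ω => (baseChange τ.toRingHom).obj V) τ

/-- The canonical family `φ σ : σ(∏ τV) → ∏ τV`, acting on the factor `σ(τV)` as the canonical
isomorphism `σ(τV) ≅ (στ)V`: the component at `ρ` uses the factor `τ = σ⁻¹ρ`. -/
def conjProdDescent (V : Over (Spec (CommRingCat.of K))) (σ : Ω ≃ₐ[k] Ω) :
    (baseChange (galHom σ)).obj (conjProd k Ω V) ⟶ conjProd k Ω V :=
  Pi.lift fun ρ : K →ₐ[k] Ω =>
    (baseChange (galHom σ)).map (conjProdπ V ((σ.symm : Ω →ₐ[k] Ω).comp ρ)) ≫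
      (baseChangeComp ((σ.symm : Ω →ₐ[k] Ω).comp ρ).toRingHom (galHom σ) ρ.toRingHom
        (RingHom.ext fun x => σ.apply_symm_apply (ρ x)) V).hom

end Conjugates

end

end WeilRes

/-! The Weil restriction is constructed over `k` directly, as an object representing `T ↦ Hom_K(T_K,
V)` on all `k`-schemes. Only afterwards is it compared with the product of conjugates, so no descent
datum ever has to be shown effective.

Existence. The functor is a Zariski sheaf. For affine `V` it is represented by an algebra whose
generators are the coordinates, in a `k`-basis of `K`, of the images of the functions on `V`
(`exists_algebra_restriction`). Since `Spec K → Spec k` is universally closed, the part of `T` over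
which `T_K → V` lands in an open `U ⊆ V` is open, so affine opens of `V` give open subfunctors.
These cover: the fibres of `T_K → T` are finite, and homogeneous prime avoidance puts any finite set
of points of a quasi-projective scheme into an affine open. Local representability then glues
(`exists_isUniversal_of_cover`).

Comparison. By independence of characters and a dimension count, `Ω ⊗ K` is a product of copies of
`Ω` indexed by the embeddings `τ`. Hence, for an `Ω`-scheme `T`, its base change from `k` to `K` is
a disjoint union of copies of `T`, and `Hom_Ω(T, W_Ω) = Hom_k(T, W) = Hom_K(T_K, V) = ∏ Hom_Ω(T,
τV)`. By Yoneda the map `W_Ω → ∏ τV` with components `τφ` is an isomorphism (`isIso_toConjProd`). It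
splits the canonical family, and a split family satisfies the cocycle identity formally.
Separatedness and finite type descend to `W` from the product over an algebraic closure of `K`. -/

namespace WeilRes

/-! ### Points of the Weil restriction; gluing along open covers -/

/-- A `T`-point of the Weil restriction of `q : V ⟶ S'` along `s : S' ⟶ S`: a morphism `t : T ⟶ S`
and an `S'`-morphism `T ×[S] S' ⟶ V`. -/
structure Point {S S' V : Scheme.{u}} (s : S' ⟶ S) (q : V ⟶ S') (T : Scheme.{u}) where
  /-- the structure morphism -/
  t : T ⟶ S
  /-- the morphism from the base change -/
  g : pullback t s ⟶ V
  w : g ≫ q = pullback.snd t s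

namespace Point

variable {S S' V : Scheme.{u}} {s : S' ⟶ S} {q : V ⟶ S'} {T T' T'' Z Z' : Scheme.{u}}

/-- The value of a point on a pair of morphisms to `T` and `S'` which agree over `S`. -/
noncomputable def ev (a : Point s q T) (x : Z ⟶ T) (y : Z ⟶ S') (h : x ≫ a.t = y ≫ s) : Z ⟶ V :=
  pullback.lift x y h ≫ a.g

lemma ev_comp_hom (a : Point s q T) (x : Z ⟶ T) (y : Z ⟶ S') (h : x ≫ a.t = y ≫ s) :
    a.ev x y h ≫ q = y := by
  rw [ev, Category.assoc, a.w, pullback.lift_snd]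

lemma comp_ev (a : Point s q T) (x : Z ⟶ T) (y : Z ⟶ S') (h : x ≫ a.t = y ≫ s) (z : Z' ⟶ Z) :
    z ≫ a.ev x y h = a.ev (z ≫ x) (z ≫ y) (by simp only [Category.assoc, h]) := by
  rw [ev, ev, ← Category.assoc]
  congr 1
  apply pullback.hom_ext
  · rw [Category.assoc, pullback.lift_fst, pullback.lift_fst]
  · rw [Category.assoc, pullback.lift_snd, pullback.lift_snd]

lemma ev_fst_snd (a : Point s q T) :
    a.ev (pullback.fst a.t s) (pullback.snd a.t s) pullback.condition = a.g := by
  rw [ev, pullback.lift_fst_snd, Category.id_comp]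

/-- Comparing values avoids transporting `g` between the fibre products formed with `a.t` and with
`b.t`. -/
lemma ext_ev {a b : Point s q T} (ht : a.t = b.t)
    (h : ∀ (Z : Scheme.{u}) (x : Z ⟶ T) (y : Z ⟶ S') (h₁ : x ≫ a.t = y ≫ s)
      (h₂ : x ≫ b.t = y ≫ s), a.ev x y h₁ = b.ev x y h₂) : a = b := by
  obtain ⟨t, g, w⟩ := a
  obtain ⟨t', g', w'⟩ := b
  obtain rfl : t = t' := ht
  have := h _ (pullback.fst t s) (pullback.snd t s) pullback.condition pullback.condition
  simp only [ev, pullback.lift_fst_snd, Category.id_comp] at this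
  subst this
  rfl

lemma ev_congr {a b : Point s q T} (hab : a = b) {x x' : Z ⟶ T} (hx : x = x') {y y' : Z ⟶ S'}
    (hy : y = y') (h : x ≫ a.t = y ≫ s) :
    a.ev x y h = b.ev x' y' (by rw [← hx, ← hy, ← hab, h]) := by
  subst hab hx hy
  rfl

/-- The pullback of a point along `h : T' ⟶ T`. -/
noncomputable def pull (h : T' ⟶ T) (a : Point s q T) : Point s q T' where
  t := h ≫ a.t
  g := a.ev (pullback.fst _ _ ≫ h) (pullback.snd _ _) (by rw [Category.assoc, pullback.condition])
  w := a.ev_comp_hom _ _ _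

lemma pull_t (h : T' ⟶ T) (a : Point s q T) : (a.pull h).t = h ≫ a.t := rfl

lemma pull_ev (h : T' ⟶ T) (a : Point s q T) (x : Z ⟶ T') (y : Z ⟶ S')
    (e : x ≫ (a.pull h).t = y ≫ s) :
    (a.pull h).ev x y e = a.ev (x ≫ h) y (by rw [Category.assoc, ← pull_t, e]) := by
  refine (a.comp_ev _ _ _ (pullback.lift x y e)).trans (ev_congr rfl ?_ (pullback.lift_snd _ _ _) _)
  exact (Category.assoc _ _ _).symm.trans (congrArg (· ≫ h) (pullback.lift_fst _ _ _))

@[simp]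
lemma pull_id (a : Point s q T) : a.pull (𝟙 T) = a :=
  ext_ev (Category.id_comp _) fun Z x y _ _ ↦ by
    rw [pull_ev]; exact ev_congr rfl (Category.comp_id _) rfl _

lemma pull_pull (h : T' ⟶ T) (h' : T'' ⟶ T') (a : Point s q T) :
    (a.pull h).pull h' = a.pull (h' ≫ h) :=
  ext_ev (Category.assoc _ _ _).symm fun Z x y _ _ ↦ by
    rw [pull_ev, pull_ev, pull_ev]; exact ev_congr rfl (Category.assoc _ _ _) rfl _

/-- The image of a point under a morphism of targets. -/
noncomputable def post {V' : Scheme.{u}} (i : V' ⟶ V) (a : Point s (i ≫ q) T) : Point s q T where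
  t := a.t
  g := a.g ≫ i
  w := by rw [Category.assoc, a.w]

lemma post_t {V' : Scheme.{u}} (i : V' ⟶ V) (a : Point s (i ≫ q) T) : (a.post i).t = a.t := rfl

lemma post_ev {V' : Scheme.{u}} (i : V' ⟶ V) (a : Point s (i ≫ q) T) (x : Z ⟶ T) (y : Z ⟶ S')
    (h : x ≫ (a.post i).t = y ≫ s) :
    (a.post i).ev x y h = a.ev x y (by rw [← post_t, h]) ≫ i :=
  (Category.assoc _ _ _).symm

lemma pull_post {V' : Scheme.{u}} (i : V' ⟶ V) (a : Point s (i ≫ q) T) (h : T' ⟶ T) :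
    (a.post i).pull h = (a.pull h).post i :=
  ext_ev rfl fun Z x y e _ ↦ by
    rw [pull_ev, post_ev, post_ev, pull_ev]

lemma post_injective {V' : Scheme.{u}} (i : V' ⟶ V) [Mono i] :
    Function.Injective (post (s := s) (q := q) (T := T) i) := by
  intro a b hab
  refine ext_ev (congrArg (fun c : Point s q T ↦ c.t) hab) fun Z x y h₁ h₂ ↦ ?_
  rw [← cancel_mono i]
  exact (post_ev i a x y h₁).symm.trans ((ev_congr hab rfl rfl _).trans (post_ev i b x y h₂))

lemma exists_glue_pullback (𝒰 : T.OpenCover) {P : Scheme.{u}} (p : P ⟶ T)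
    (γ : ∀ i, pullback p (𝒰.f i) ⟶ V)
    (hγ : ∀ (i j) (Z : Scheme.{u}) (p₁ : Z ⟶ pullback p (𝒰.f i)) (p₂ : Z ⟶ pullback p (𝒰.f j)),
      p₁ ≫ pullback.fst _ _ = p₂ ≫ pullback.fst _ _ → p₁ ≫ γ i = p₂ ≫ γ j) :
    ∃ g : P ⟶ V, ∀ i, pullback.fst p (𝒰.f i) ≫ g = γ i :=
  ⟨Scheme.Cover.glueMorphisms (𝒰.pullback₁ p) γ fun i j ↦ hγ i j _ _ _ pullback.condition,
    Scheme.Cover.ι_glueMorphisms (𝒰.pullback₁ p) γ _⟩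

lemma hom_ext_pullback (𝒰 : T.OpenCover) {P : Scheme.{u}} (p : P ⟶ T) {g g' : P ⟶ V}
    (h : ∀ i, pullback.fst p (𝒰.f i) ≫ g = pullback.fst p (𝒰.f i) ≫ g') : g = g' :=
  Scheme.Cover.hom_ext (𝒰.pullback₁ p) _ _ h

/-- Points are local on `T`: they can be glued along open covers. -/
theorem existsUnique_glue (𝒰 : T.OpenCover) (x : ∀ i, Point s q (𝒰.X i))
    (hx : ∀ (i j) (Z : Scheme.{u}) (a : Z ⟶ 𝒰.X i) (b : Z ⟶ 𝒰.X j), a ≫ 𝒰.f i = b ≫ 𝒰.f j →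
      (x i).pull a = (x j).pull b) :
    ∃! a : Point s q T, ∀ i, a.pull (𝒰.f i) = x i := by
  obtain ⟨t, ht⟩ : ∃ t : T ⟶ S, ∀ i, 𝒰.f i ≫ t = (x i).t :=
    ⟨𝒰.glueMorphisms (fun i ↦ (x i).t) fun i j ↦
      congrArg Point.t (hx i j _ _ _ pullback.condition), 𝒰.ι_glueMorphisms _ _⟩
  have h₁ (i) : pullback.snd (pullback.fst t s) (𝒰.f i) ≫ (x i).t =
      (pullback.fst (pullback.fst t s) (𝒰.f i) ≫ pullback.snd t s) ≫ s := by
    rw [← ht, ← Category.assoc, ← pullback.condition, Category.assoc, Category.assoc,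
      pullback.condition]
  -- The fibre product of `t` and `s` is covered by the preimages of the members of `𝒰`; on the
  -- `i`-th one the glued morphism must be the value of `x i`.
  obtain ⟨g, hg⟩ := exists_glue_pullback (V := V) 𝒰 (pullback.fst t s) (fun i ↦ (x i).ev
    (pullback.snd (pullback.fst t s) (𝒰.f i))
    (pullback.fst (pullback.fst t s) (𝒰.f i) ≫ pullback.snd t s) (h₁ i)) <| by
    intro i j Z p₁ p₂ c
    have ha : (p₁ ≫ pullback.snd (pullback.fst t s) (𝒰.f i)) ≫ 𝒰.f i =
        (p₂ ≫ pullback.snd (pullback.fst t s) (𝒰.f j)) ≫ 𝒰.f j := by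
      rw [Category.assoc, Category.assoc, ← pullback.condition, ← pullback.condition,
        reassoc_of% c]
    have hb : 𝟙 _ ≫ ((x i).pull (p₁ ≫ pullback.snd (pullback.fst t s) (𝒰.f i))).t =
        (p₁ ≫ pullback.fst (pullback.fst t s) (𝒰.f i) ≫ pullback.snd t s) ≫ s := by
      rw [pull_t, Category.id_comp, Category.assoc, h₁]
      simp only [Category.assoc]
    have := ev_congr (hx i j _ _ _ ha) rfl rfl hb
    rw [pull_ev, pull_ev] at this
    refine (comp_ev _ _ _ _ _).trans ((ev_congr rfl (Category.id_comp _).symm rfl _).trans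
      (this.trans ((ev_congr rfl (Category.id_comp _) ?_ _).trans (comp_ev _ _ _ _ _).symm)))
    exact (Category.assoc _ _ _).symm.trans
      ((congrArg (· ≫ pullback.snd t s) c).trans (Category.assoc _ _ _))
  refine ⟨⟨t, g, hom_ext_pullback 𝒰 (pullback.fst t s) fun i ↦ ?_⟩, fun i ↦ ?_, ?_⟩
  · rw [← Category.assoc, hg, ev_comp_hom]
  · refine ext_ev (ht i) fun Z u v e₁ e₂ ↦ ?_
    have e : (u ≫ 𝒰.f i) ≫ t = v ≫ s := by rw [Category.assoc, ht, e₂]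
    rw [pull_ev]
    -- The pair factors through the `i`-th member of the pulled back cover, where `g` is known.
    have hz : pullback.lift (u ≫ 𝒰.f i) v e = pullback.lift (f := pullback.fst t s)
        (pullback.lift (u ≫ 𝒰.f i) v e) u (pullback.lift_fst _ _ _) ≫ pullback.fst _ _ :=
      (pullback.lift_fst _ _ _).symm
    change pullback.lift _ _ e ≫ g = _
    rw [hz, Category.assoc, hg, comp_ev]
    refine ev_congr rfl (pullback.lift_snd _ _ _) ?_ _
    rw [← Category.assoc, ← hz, pullback.lift_snd]
  · intro b hb
    have htb : b.t = t := 𝒰.hom_ext _ _ fun i ↦ by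
      rw [ht, ← hb]; rfl
    obtain ⟨tb, gb, wb⟩ := b
    obtain rfl : tb = t := htb
    congr 1
    refine hom_ext_pullback 𝒰 (pullback.fst tb s) fun i ↦ ?_
    rw [hg]
    have e := h₁ i
    rw [← hb i] at e
    refine (?_ : _ = ((⟨tb, gb, wb⟩ : Point s q T).pull (𝒰.f i)).ev _ _ e).trans
      (ev_congr (hb i) rfl rfl _)
    rw [pull_ev, ev]
    refine congrArg (· ≫ gb) (pullback.hom_ext ?_ ?_)
    · exact pullback.condition.trans (pullback.lift_fst _ _ _).symm
    · exact (pullback.lift_snd _ _ _).symm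

lemma ext_cover (𝒰 : T.OpenCover) {a b : Point s q T}
    (h : ∀ i, a.pull (𝒰.f i) = b.pull (𝒰.f i)) : a = b :=
  (existsUnique_glue 𝒰 (fun i ↦ b.pull (𝒰.f i)) fun i j Z u v e ↦ by
    rw [pull_pull, pull_pull, e]).unique h fun _ ↦ rfl

end Point

/-- The presheaf of points of the Weil restriction. -/
noncomputable def pointPresheaf {S S' V : Scheme.{u}} (s : S' ⟶ S) (q : V ⟶ S') :
    Scheme.{u}ᵒᵖ ⥤ Type u where
  obj T := Point s q T.unop
  map h := TypeCat.ofHom (Point.pull h.unop)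
  map_id T := by ext a; exact a.pull_id
  map_comp f g := by ext a; exact (Point.pull_pull _ _ a).symm

lemma isSheaf_pointPresheaf {S S' V : Scheme.{u}} (s : S' ⟶ S) (q : V ⟶ S') :
    Presheaf.IsSheaf Scheme.zariskiTopology (pointPresheaf s q) := by
  rw [isSheaf_iff_isSheaf_of_type, Precoverage.isSheaf_toGrothendieck_iff_of_isStableUnderBaseChange]
  rintro Y R hR x hx
  obtain ⟨(𝒰 : Scheme.OpenCover Y), rfl⟩ := Scheme.exists_cover_of_mem_pretopology hR
  obtain ⟨a, ha, ha'⟩ := Point.existsUnique_glue 𝒰 (fun i ↦ x (𝒰.f i) (.mk i))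
    fun i j Z a b hab ↦ hx a b (.mk i) (.mk j) hab
  refine ⟨a, ?_, fun b hb ↦ ha' b fun i ↦ hb _ (.mk i)⟩
  rintro Z e ⟨i⟩
  exact ha i

end WeilRes

/-! ### Open subfunctors and local representability -/

namespace WeilRes

variable {S S' V : Scheme.{u}} {s : S' ⟶ S} {q : V ⟶ S'}

/-- The point `x` of `W` is universal, i.e. `W` is the Weil restriction of `q : V ⟶ S'` along
`s`. -/
def Point.IsUniversal {W : Scheme.{u}} (x : Point s q W) : Prop :=
  ∀ T : Scheme.{u}, Function.Bijective fun ψ : T ⟶ W ↦ x.pull ψ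

lemma Point.ev_apply {T Z : Scheme.{u}} (a : Point s q T) (x : Z ⟶ T) (y : Z ⟶ S')
    (h : x ≫ a.t = y ≫ s) (z : Z) : a.ev x y h z = a.g (pullback.lift x y h z) :=
  Scheme.Hom.comp_apply _ _ _

/-- If `s` is universally closed and `i` is an open immersion into `V`, then the locus where a
point of `V` factors through `i` is open. -/
lemma Point.exists_locus [UniversallyClosed s] {U T : Scheme.{u}} (i : U ⟶ V) [IsOpenImmersion i]
    (a : Point s q T) :
    ∃ L : T.Opens,
      (∀ t : T, (∀ z, pullback.fst a.t s z = t → a.g z ∈ Set.range i) → t ∈ L) ∧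
      ∀ (T' : Scheme.{u}) (h : T' ⟶ T),
        (∃ b : Point s (i ≫ q) T', b.post i = a.pull h) ↔ Set.range h ⊆ L := by
  -- The bad locus: the image in `T` of the closed set of points not sent into `U`. It is closed
  -- because the base change of `s` is a closed map.
  let Z : Set T := pullback.fst a.t s '' (a.g ⁻¹' Set.range i)ᶜ
  have hZ : IsClosed Z := (pullback.fst a.t s).isClosedMap _
    (i.isOpenEmbedding.isOpen_range.preimage a.g.continuous).isClosed_compl
  have hmem (t : T) : t ∈ Zᶜ ↔ ∀ z, pullback.fst a.t s z = t → a.g z ∈ Set.range i := by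
    simp only [Z, Set.mem_compl_iff, Set.mem_image, Set.mem_preimage, not_exists, not_and]
    exact forall_congr' fun z ↦ by rw [not_imp_not]
  refine ⟨⟨Zᶜ, hZ.isOpen_compl⟩, fun t ht ↦ (hmem t).2 ht, fun T' h ↦ ⟨?_, fun hh ↦ ?_⟩⟩
  · rintro ⟨b, hb⟩ _ ⟨t', rfl⟩
    refine (hmem _).2 fun z hz ↦ ?_
    -- Lift `z` to the base change along `h`; there the value of `a` equals that of `b` followed by
    -- `i`.
    obtain ⟨z', hz', hz''⟩ := Scheme.Pullback.exists_preimage_pullback z t' hz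
    have e : (pullback.snd (pullback.fst a.t s) h ≫ h) ≫ a.t =
        (pullback.fst (pullback.fst a.t s) h ≫ pullback.snd a.t s) ≫ s := by
      rw [← pullback.condition, Category.assoc, Category.assoc, pullback.condition]
    have e₁ : pullback.snd (pullback.fst a.t s) h ≫ (a.pull h).t =
        (pullback.fst (pullback.fst a.t s) h ≫ pullback.snd a.t s) ≫ s := by
      rw [pull_t, ← Category.assoc, e]
    have e₂ : pullback.snd (pullback.fst a.t s) h ≫ (b.post i).t =
        (pullback.fst (pullback.fst a.t s) h ≫ pullback.snd a.t s) ≫ s := by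
      rw [hb, e₁]
    have key : a.ev _ _ e = pullback.fst (pullback.fst a.t s) h ≫ a.g := by
      rw [ev]
      refine congrArg (· ≫ a.g) (pullback.hom_ext ?_ ?_)
      · rw [pullback.lift_fst, pullback.condition]
      · rw [pullback.lift_snd]
    have key' : a.ev _ _ e = b.ev _ _ e₂ ≫ i :=
      (pull_ev h a _ _ e₁).symm.trans ((ev_congr hb.symm rfl rfl e₁).trans (post_ev i b _ _ e₂))
    rw [← hz', ← Scheme.Hom.comp_apply, ← key, key', Scheme.Hom.comp_apply]
    exact ⟨_, rfl⟩
  · have hr : Set.range (a.pull h).g ⊆ Set.range i := by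
      rintro _ ⟨z, rfl⟩
      let z' : ↥(pullback (h ≫ a.t) s) := z
      have hl : (pullback.fst (h ≫ a.t) s ≫ h) ≫ a.t = pullback.snd (h ≫ a.t) s ≫ s := by
        rw [Category.assoc, pullback.condition]
      have hz : (a.pull h).g z = a.g (pullback.lift _ _ hl z') := a.ev_apply _ _ hl z'
      rw [hz]
      refine (hmem _).1 (hh ⟨pullback.fst (h ≫ a.t) s z', rfl⟩) _ ?_
      rw [← Scheme.Hom.comp_apply, pullback.lift_fst, Scheme.Hom.comp_apply]
    refine ⟨⟨(a.pull h).t, IsOpenImmersion.lift i (a.pull h).g hr, ?_⟩, ?_⟩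
    · rw [← Category.assoc, IsOpenImmersion.lift_fac, (a.pull h).w]
    · unfold post
      congr 1
      exact IsOpenImmersion.lift_fac _ _ _


/-- The morphism from a representable presheaf to the presheaf of points given by a point. -/
noncomputable def Point.toPresheaf {W : Scheme.{u}} (x : Point s q W) :
    yoneda.obj W ⟶ pointPresheaf s q where
  app T := TypeCat.ofHom fun ψ : T.unop ⟶ W ↦ x.pull ψ
  naturality T T' f := by
    ext ψ
    exact (pull_pull _ _ _).symm

lemma Point.toPresheaf_app {W T : Scheme.{u}} (x : Point s q W) (ψ : T ⟶ W) :
    x.toPresheaf.app (Opposite.op T) ψ = x.pull ψ := rfl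

lemma Point.eq_toPresheaf {W : Scheme.{u}} (f : yoneda.obj W ⟶ pointPresheaf s q) :
    ∃ x : Point s q W, f = x.toPresheaf := by
  refine ⟨f.app (Opposite.op W) (𝟙 W), ?_⟩
  apply yonedaEquiv.injective
  rw [yonedaEquiv_apply, yonedaEquiv_apply]
  exact (Point.pull_id _).symm

/-- The fibre product with a `T`-point `a` is the open locus `L` where `a` factors through `U`;
universality of `x` turns the factored point over `L` into the other projection `L ⟶ W`. -/
lemma Point.isOpenImmersion_toPresheaf_post [UniversallyClosed s] {U W : Scheme.{u}} (i : U ⟶ V)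
    [IsOpenImmersion i] {x : Point s (i ≫ q) W} (hx : x.IsUniversal) :
    IsOpenImmersion.presheaf (x.post i).toPresheaf := by
  refine MorphismProperty.relative.of_exists fun T f ↦ ?_
  obtain ⟨a, rfl⟩ := Point.eq_toPresheaf f
  obtain ⟨L, -, hL⟩ := a.exists_locus i
  obtain ⟨b, hb⟩ := (hL L L.ι).2 L.range_ι.subset
  obtain ⟨ψ, hψ⟩ := (hx L).2 b
  refine ⟨L, yoneda.map ψ, L.ι, ?_, inferInstance⟩
  refine IsPullback.of_forall_isPullback_app fun T' ↦ ?_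
  rw [Types.isPullback_iff]
  have hpost {T'' : Scheme.{u}} (c : T'' ⟶ L) :
      (x.post i).pull (c ≫ ψ) = a.pull (c ≫ L.ι) := by
    rw [← pull_pull, ← pull_pull, pull_post]
    exact congrArg (pull c) ((congrArg (post i) hψ).trans hb)
  refine ⟨?_, ?_, ?_⟩
  · ext c
    exact hpost c
  · rintro c d ⟨-, h⟩
    exact (cancel_mono L.ι).1 h
  · intro c (d : T'.unop ⟶ T) h
    replace h : (x.post i).pull c = a.pull d := h
    have hd := (hL _ d).1 ⟨x.pull c, by rw [← pull_post, h]⟩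
    have hd' : Set.range d ⊆ Set.range L.ι := by rwa [L.range_ι]
    refine ⟨IsOpenImmersion.lift L.ι d hd', ?_, IsOpenImmersion.lift_fac _ _ _⟩
    refine (hx _).1 (Point.post_injective i ?_)
    change (x.pull (IsOpenImmersion.lift L.ι d hd' ≫ ψ)).post i = (x.pull c).post i
    rw [← pull_post, ← pull_post, hpost, IsOpenImmersion.lift_fac, h]

/-- The Weil restriction along a universally closed morphism exists if it exists for the members
of a family of open subschemes such that the points of `V` over each point of the base of any
point of the Weil restriction lie in one of them. -/
theorem exists_isUniversal_of_cover [UniversallyClosed s] {ι : Type u} {U : ι → Scheme.{u}}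
    (i : ∀ j, U j ⟶ V) [∀ j, IsOpenImmersion (i j)]
    (hU : ∀ j, ∃ (W : Scheme.{u}) (x : Point s (i j ≫ q) W), x.IsUniversal)
    (hcov : ∀ (T : Scheme.{u}) (a : Point s q T) (t : T), ∃ j, ∀ z, pullback.fst a.t s z = t →
      a.g z ∈ Set.range (i j)) :
    ∃ (W : Scheme.{u}) (x : Point s q W), x.IsUniversal := by
  choose W x hx using hU
  let F : Sheaf Scheme.zariskiTopology.{u} (Type u) :=
    ⟨pointPresheaf s q, isSheaf_pointPresheaf s q⟩
  let f (j) : yoneda.obj (W j) ⟶ F.1 := ((x j).post (i j)).toPresheaf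
  have hf (j) : IsOpenImmersion.presheaf (f j) :=
    Point.isOpenImmersion_toPresheaf_post (i j) (hx j)
  have : Presheaf.IsLocallySurjective Scheme.zariskiTopology (Sigma.desc f) := by
    refine ⟨fun {T} (a : Point s q T) ↦ ?_⟩
    choose j hj using hcov T a
    choose L hL hL' using fun j ↦ a.exists_locus (i j)
    -- For each point `t`, `hcov` supplies an index whose locus contains `t`, so these loci cover
    -- `T`; on each of them `a` lifts to some `W j`.
    let 𝒰 := T.openCoverOfIsOpenCover (fun t ↦ L (j t))
      (eq_top_iff.2 fun t _ ↦ TopologicalSpace.Opens.mem_iSup.2 ⟨t, hL _ t (hj t)⟩)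
    refine Scheme.zariskiTopology.superset_covering ?_ 𝒰.mem_grothendieckTopology
    rw [Sieve.generate_le_iff]
    rintro _ _ ⟨t⟩
    obtain ⟨b, hb⟩ := (hL' (j t) (L (j t)) (L (j t)).ι).2 (L (j t)).range_ι.subset
    obtain ⟨ψ, hψ⟩ := (hx (j t) _).2 b
    refine ⟨(Sigma.ι (fun j ↦ yoneda.obj (W j)) (j t)).app (Opposite.op (L (j t)).toScheme) ψ, ?_⟩
    have : (Sigma.ι (fun j ↦ yoneda.obj (W j)) (j t) ≫ Sigma.desc f).app
        (Opposite.op (L (j t)).toScheme) ψ = (f (j t)).app _ ψ := by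
      rw [Sigma.ι_desc]; rfl
    refine Eq.trans this ?_
    refine (Point.toPresheaf_app _ ψ).trans ?_
    rw [Point.pull_post]
    exact (congrArg (Point.post _) hψ).trans hb
  obtain ⟨W₀, ⟨r⟩⟩ := Scheme.LocalRepresentability.isRepresentable hf
  refine ⟨W₀, r.homEquiv (𝟙 W₀), fun T ↦ ?_⟩
  have h : (fun ψ : T ⟶ W₀ ↦ Point.pull ψ (r.homEquiv (𝟙 W₀) : Point s q W₀)) =
      (r.homEquiv : (T ⟶ W₀) ≃ _) := funext fun ψ ↦ (r.homEquiv_eq ψ).symm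
  rw [h]
  exact r.homEquiv.bijective

end WeilRes

/-! ### Restriction of algebras by generators and relations -/

namespace WeilRes

open TensorProduct

section Coefficients

variable {k K : Type u} [CommRing k] [CommRing K] [Algebra k K] {ι : Type u}
  (b : Module.Basis ι k K)

/-- The coefficient of an element of `K ⊗[k] B` at a member of a basis of `K` over `k`. -/
noncomputable def tensorCoeff (B : Type u) [CommRing B] [Algebra k B] (i : ι) :
    K ⊗[k] B →ₗ[k] B :=
  (TensorProduct.lid k B).toLinearMap ∘ₗ (b.coord i).rTensor B

variable {B C : Type u} [CommRing B] [Algebra k B] [CommRing C] [Algebra k C]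

@[simp]
lemma tensorCoeff_tmul (i : ι) (x : K) (y : B) :
    tensorCoeff b B i (x ⊗ₜ y) = b.repr x i • y := by
  simp [tensorCoeff]

lemma sum_tensorCoeff [Fintype ι] (z : K ⊗[k] B) : ∑ i, b i ⊗ₜ[k] tensorCoeff b B i z = z := by
  induction z with
  | zero => simp
  | add x y hx hy => simp only [map_add, TensorProduct.tmul_add, Finset.sum_add_distrib, hx, hy]
  | tmul x y =>
    simp only [tensorCoeff_tmul, ← TensorProduct.smul_tmul, ← TensorProduct.sum_tmul, b.sum_repr]

lemma tensorCoeff_map (ψ : B →ₐ[k] C) (i : ι) (z : K ⊗[k] B) :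
    tensorCoeff b C i (Algebra.TensorProduct.map (AlgHom.id K K) ψ z) =
      ψ (tensorCoeff b B i z) := by
  induction z with
  | zero => simp
  | add x y hx hy => simp only [map_add, hx, hy]
  | tmul x y => simp

lemma tensor_eq_zero_of_tensorCoeff [Fintype ι] {z : K ⊗[k] B} (h : ∀ i, tensorCoeff b B i z = 0) :
    z = 0 := by
  rw [← sum_tensorCoeff b z]
  simp [h]

end Coefficients

section AlgebraRestriction

variable (k K A : Type u) [CommRing k] [CommRing K] [Algebra k K] [Module.Free k K]
  [Module.Finite k K] [CommRing A] [Algebra K A]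

/-- The functor `B ↦ K ⊗[k] B` from `k`-algebras to `K`-algebras, for `K` finite and free over
`k`, has a left adjoint. -/
theorem exists_algebra_restriction :
    ∃ (R : Type u) (_ : CommRing R) (_ : Algebra k R) (Φ : A →ₐ[K] K ⊗[k] R),
      ∀ (B : Type u) [CommRing B] [Algebra k B] (g : A →ₐ[K] K ⊗[k] B),
        ∃! ψ : R →ₐ[k] B, (Algebra.TensorProduct.map (AlgHom.id K K) ψ).comp Φ = g := by
  classical
  let ι := Module.Free.ChooseBasisIndex k K
  let b : Module.Basis ι k K := Module.Free.chooseBasis k K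
  let P := MvPolynomial (A × ι) k
  -- The generic image of `a`: its coordinates in the basis `b` are independent variables.
  let X : A → K ⊗[k] P := fun a ↦ ∑ i, b i ⊗ₜ[k] MvPolynomial.X (a, i)
  have hX (a i) : tensorCoeff b P i (X a) = MvPolynomial.X (a, i) := by
    simp [X, Finsupp.single_apply, ite_smul]
  -- The conditions for `a ↦ X a` to be a `K`-algebra homomorphism; preservation of `0` and `1` is
  -- contained in the scalar relations. `J` imposes them coordinate by coordinate.
  let rel : Set (K ⊗[k] P) :=
    {z | (∃ a a', z = X (a + a') - (X a + X a')) ∨ (∃ a a', z = X (a * a') - X a * X a') ∨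
      ∃ r, z = X (algebraMap K A r) - algebraMap K _ r}
  let J : Ideal P := Ideal.span {p | ∃ z ∈ rel, ∃ i, p = tensorCoeff b P i z}
  let π : P →ₐ[k] P ⧸ J := Ideal.Quotient.mkₐ k J
  have hrel {z} (hz : z ∈ rel) : Algebra.TensorProduct.map (AlgHom.id K K) π z = 0 := by
    refine tensor_eq_zero_of_tensorCoeff b fun i ↦ ?_
    rw [tensorCoeff_map]
    exact Ideal.Quotient.eq_zero_iff_mem.2 (Ideal.subset_span ⟨z, hz, i, rfl⟩)
  have hadd (a a') := sub_eq_zero.1 ((map_sub _ _ _).symm.trans (hrel (Or.inl ⟨a, a', rfl⟩)))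
  have hmul (a a') := sub_eq_zero.1 ((map_sub _ _ _).symm.trans
    (hrel (Or.inr (Or.inl ⟨a, a', rfl⟩))))
  have halg (r) := sub_eq_zero.1 ((map_sub _ _ _).symm.trans (hrel (Or.inr (Or.inr ⟨r, rfl⟩))))
  let Φ : A →ₐ[K] K ⊗[k] (P ⧸ J) :=
    { toFun := fun a ↦ Algebra.TensorProduct.map (AlgHom.id K K) π (X a)
      map_one' := by simpa using halg 1
      map_mul' := fun a a' ↦ by rw [hmul, map_mul]
      map_zero' := by simpa using halg 0
      map_add' := fun a a' ↦ by rw [hadd, map_add]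
      commutes' := fun r ↦ by rw [halg]; exact AlgHom.commutes _ r }
  refine ⟨P ⧸ J, inferInstance, inferInstance, Φ, fun B _ _ g ↦ ?_⟩
  let θ : P →ₐ[k] B := MvPolynomial.aeval fun p ↦ tensorCoeff b B p.2 (g p.1)
  have hθ (a) : Algebra.TensorProduct.map (AlgHom.id K K) θ (X a) = g a := by
    have hθX (i) : θ (MvPolynomial.X (a, i)) = tensorCoeff b B i (g a) := MvPolynomial.aeval_X _ _
    simp only [X, map_sum, Algebra.TensorProduct.map_tmul, AlgHom.id_apply, hθX]
    exact sum_tensorCoeff b (g a)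
  have hJ : ∀ p ∈ J, θ p = 0 := by
    intro p hp
    have : J ≤ RingHom.ker θ := by
      refine Ideal.span_le.2 ?_
      rintro _ ⟨z, hz, i, rfl⟩
      refine (tensorCoeff_map b θ i z).symm.trans ?_
      rw [show Algebra.TensorProduct.map (AlgHom.id K K) θ z = 0 from ?_, map_zero]
      rcases hz with ⟨a, a', rfl⟩ | ⟨a, a', rfl⟩ | ⟨r, rfl⟩
      · rw [map_sub, map_add, hθ, hθ, hθ, map_add, sub_self]
      · rw [map_sub, map_mul, hθ, hθ, hθ, map_mul, sub_self]
      · rw [map_sub, hθ, AlgHom.commutes, AlgHom.commutes, sub_self]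
    exact this hp
  have hcomp (ψ : P ⧸ J →ₐ[k] B) (z : K ⊗[k] P) :
      Algebra.TensorProduct.map (AlgHom.id K K) ψ
        (Algebra.TensorProduct.map (AlgHom.id K K) π z) =
      Algebra.TensorProduct.map (AlgHom.id K K) (ψ.comp π) z := by
    refine tensor_eq_zero_of_tensorCoeff b (fun i ↦ ?_) |> sub_eq_zero.1
    rw [map_sub, tensorCoeff_map, tensorCoeff_map, tensorCoeff_map]
    exact sub_self _
  refine ⟨Ideal.Quotient.liftₐ J θ hJ, ?_, fun ψ hψ ↦ ?_⟩
  · ext a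
    refine (hcomp _ _).trans ?_
    rw [show (Ideal.Quotient.liftₐ J θ hJ).comp π = θ from Ideal.Quotient.liftₐ_comp J θ hJ, hθ]
  · refine Ideal.Quotient.algHom_ext k ?_
    change ψ.comp π = (Ideal.Quotient.liftₐ J θ hJ).comp π
    rw [show (Ideal.Quotient.liftₐ J θ hJ).comp π = θ from Ideal.Quotient.liftₐ_comp J θ hJ]
    -- Uniqueness: the value of `ψ` on the variable `(a, i)` is the `i`-th coordinate of `g a`.
    refine MvPolynomial.algHom_ext fun ⟨a, i⟩ ↦ ?_
    rw [← hX, ← tensorCoeff_map, ← tensorCoeff_map, ← hcomp, hθ, ← hψ]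
    rfl

end AlgebraRestriction

end WeilRes

/-! ### Weil restriction of affine schemes -/

namespace WeilRes

open TensorProduct

/-- Every pair of test morphisms factors through `P`, so one value decides. This allows `Spec (K
⊗[k] B)` to replace the chosen fibre product. -/
lemma Point.ext_of_isPullback {S S' V : Scheme.{u}} {s : S' ⟶ S} {q : V ⟶ S'} {T P : Scheme.{u}}
    {a b : Point s q T} (hab : a.t = b.t) {x : P ⟶ T} {y : P ⟶ S'} (h : IsPullback x y a.t s)
    (he : a.ev x y h.w = b.ev x y (by rw [← hab, h.w])) : a = b := by
  refine ext_ev hab fun Z x' y' h₁ h₂ ↦ ?_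
  rw [← ev_congr rfl (h.lift_fst x' y' h₁) (h.lift_snd x' y' h₁) (by simpa using h₁),
    ← ev_congr rfl (h.lift_fst x' y' h₁) (h.lift_snd x' y' h₁) (by simpa using h₂),
    ← comp_ev _ _ _ h.w, he, comp_ev]

section Affine

variable {k K A B C : Type u} [CommRing k] [CommRing K] [Algebra k K] [CommRing A] [Algebra K A]
  [CommRing B] [Algebra k B] [CommRing C] [Algebra k C]

lemma isPullback_Spec_tensor : IsPullback
    (Spec.map (CommRingCat.ofHom (Algebra.TensorProduct.includeRight.toRingHom : B →+* K ⊗[k] B)))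
    (Spec.map (CommRingCat.ofHom (algebraMap K (K ⊗[k] B))))
    (Spec.map (CommRingCat.ofHom (algebraMap k B)))
    (Spec.map (CommRingCat.ofHom (algebraMap k K))) :=
  isPullback_SpecMap_of_isPushout _ _ _ _ (CommRingCat.isPushout_tensorProduct k K B).flip

/-- The point with values in `Spec B` of the Weil restriction of `Spec A` defined by a
`K`-algebra homomorphism `A → K ⊗[k] B`. -/
noncomputable def Point.ofAlgHom (g : A →ₐ[K] K ⊗[k] B) :
    Point (Spec.map (CommRingCat.ofHom (algebraMap k K)))
      (Spec.map (CommRingCat.ofHom (algebraMap K A))) (Spec (CommRingCat.of B)) where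
  t := Spec.map (CommRingCat.ofHom (algebraMap k B))
  g := isPullback_Spec_tensor.isoPullback.inv ≫ Spec.map (CommRingCat.ofHom g.toRingHom)
  w := by
    rw [Category.assoc, ← Spec.map_comp, ← CommRingCat.ofHom_comp,
      show g.toRingHom.comp (algebraMap K A) = algebraMap K _ from
      g.comp_algebraMap,
      IsPullback.isoPullback_inv_snd]

lemma Point.ofAlgHom_ev (g : A →ₐ[K] K ⊗[k] B) :
    (ofAlgHom g).ev _ _ (isPullback_Spec_tensor (k := k) (K := K) (B := B)).w =
      Spec.map (CommRingCat.ofHom g.toRingHom) := by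
  have : pullback.lift _ _ (isPullback_Spec_tensor (k := k) (K := K) (B := B)).w =
      isPullback_Spec_tensor.isoPullback.hom := by
    apply pullback.hom_ext
    · rw [pullback.lift_fst, IsPullback.isoPullback_hom_fst]
    · rw [pullback.lift_snd, IsPullback.isoPullback_hom_snd]
  refine (congrArg (· ≫ (ofAlgHom g).g) this).trans ?_
  exact (Iso.hom_inv_id_assoc _ _)

lemma Point.ofAlgHom_injective :
    Function.Injective (Point.ofAlgHom : (A →ₐ[K] K ⊗[k] B) → _) := by
  intro g g' h
  have := ev_congr h rfl rfl (isPullback_Spec_tensor (k := k) (K := K) (B := B)).w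
  rw [ofAlgHom_ev] at this
  have := this.trans (ofAlgHom_ev g')
  ext a
  exact congr($(Spec.map_injective this).hom a)

lemma Point.exists_ofAlgHom (a : Point (Spec.map (CommRingCat.ofHom (algebraMap k K)))
      (Spec.map (CommRingCat.ofHom (algebraMap K A))) (Spec (CommRingCat.of B)))
    (ha : a.t = Spec.map (CommRingCat.ofHom (algebraMap k B))) :
    ∃ g : A →ₐ[K] K ⊗[k] B, Point.ofAlgHom g = a := by
  have w := (isPullback_Spec_tensor (k := k) (K := K) (B := B)).w
  rw [← ha] at w
  obtain ⟨φ, hφ⟩ := Spec.map_surjective (a.ev _ _ w)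
  have hc := a.ev_comp_hom _ _ w
  rw [← hφ, ← Spec.map_comp] at hc
  have hc' := Spec.map_injective hc
  let g : A →ₐ[K] K ⊗[k] B := { φ.hom with commutes' := fun r ↦ congr($(hc').hom r) }
  refine ⟨g, ext_of_isPullback ha.symm isPullback_Spec_tensor ?_⟩
  exact (ofAlgHom_ev g).trans hφ

lemma Point.pull_ofAlgHom (g : A →ₐ[K] K ⊗[k] B) (ψ : B →ₐ[k] C) :
    (ofAlgHom g).pull (Spec.map (CommRingCat.ofHom ψ.toRingHom)) =
      ofAlgHom ((Algebra.TensorProduct.map (AlgHom.id K K) ψ).comp g) := by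
  have ht : Spec.map (CommRingCat.ofHom ψ.toRingHom) ≫
      Spec.map (CommRingCat.ofHom (algebraMap k B)) =
      Spec.map (CommRingCat.ofHom (algebraMap k C)) := by
    rw [← Spec.map_comp, ← CommRingCat.ofHom_comp, show ψ.toRingHom.comp (algebraMap k B) =
      algebraMap k C from ψ.comp_algebraMap]
  symm
  refine ext_of_isPullback ht.symm isPullback_Spec_tensor ?_
  refine (ofAlgHom_ev _).trans ((pull_ev _ _ _ _ ?_).trans ?_).symm
  · refine Eq.trans ?_ (isPullback_Spec_tensor (k := k) (K := K) (B := C)).w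
    exact congrArg (_ ≫ ·) ht
  · have := (ofAlgHom g).comp_ev _ _ (isPullback_Spec_tensor (k := k) (K := K) (B := B)).w
      (Spec.map (CommRingCat.ofHom
        (Algebra.TensorProduct.map (AlgHom.id K K) ψ).toRingHom))
    rw [ofAlgHom_ev, ← Spec.map_comp, ← CommRingCat.ofHom_comp] at this
    refine Eq.trans (ev_congr rfl ?_ ?_ _) this.symm
    · rw [← Spec.map_comp, ← Spec.map_comp, ← CommRingCat.ofHom_comp, ← CommRingCat.ofHom_comp]
      congr 2
    · rw [← Spec.map_comp, ← CommRingCat.ofHom_comp]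
      congr 2
      ext r
      simp

end Affine

lemma Point.pull_injective_of_cover {S S' V : Scheme.{u}} {s : S' ⟶ S} {q : V ⟶ S'}
    {W T : Scheme.{u}} {x : Point s q W} (𝒰 : T.OpenCover)
    (h : ∀ i, Function.Injective fun ψ : 𝒰.X i ⟶ W ↦ x.pull ψ) :
    Function.Injective fun ψ : T ⟶ W ↦ x.pull ψ := fun _ _ e ↦
  𝒰.hom_ext _ _ fun i ↦ h i <|
    (pull_pull _ _ x).symm.trans ((congrArg (pull (𝒰.f i)) e).trans (pull_pull _ _ x))

/-- Local lifts agree on overlaps by injectivity, which is needed there for arbitrary schemes since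
the overlaps need not belong to the cover. -/
lemma Point.pull_surjective_of_cover {S S' V : Scheme.{u}} {s : S' ⟶ S} {q : V ⟶ S'}
    {W T : Scheme.{u}} {x : Point s q W} (𝒰 : T.OpenCover)
    (h : ∀ i, Function.Surjective fun ψ : 𝒰.X i ⟶ W ↦ x.pull ψ)
    (inj : ∀ Z : Scheme.{u}, Function.Injective fun ψ : Z ⟶ W ↦ x.pull ψ) :
    Function.Surjective fun ψ : T ⟶ W ↦ x.pull ψ := by
  intro a
  choose ψ hψ using fun i ↦ h i (a.pull (𝒰.f i))
  dsimp only at hψ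
  refine ⟨𝒰.glueMorphisms ψ fun i j ↦ inj _ ?_, ext_cover 𝒰 fun i ↦ ?_⟩
  · dsimp only
    rw [← pull_pull, ← pull_pull, hψ, hψ, pull_pull, pull_pull, pullback.condition]
  · rw [← hψ, pull_pull, Scheme.Cover.ι_glueMorphisms]

/-- A point is universal if it is universal for affine schemes. -/
lemma Point.isUniversal_of_affine {S S' V : Scheme.{u}} {s : S' ⟶ S} {q : V ⟶ S'} {W : Scheme.{u}}
    {x : Point s q W}
    (h : ∀ B : CommRingCat.{u}, Function.Bijective fun ψ : Spec B ⟶ W ↦ x.pull ψ) :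
    x.IsUniversal :=
  have inj (T : Scheme.{u}) := pull_injective_of_cover T.affineCover fun _ ↦ (h _).1
  fun T ↦ ⟨inj T, pull_surjective_of_cover T.affineCover (fun _ ↦ (h _).2) inj⟩

/-- The Weil restriction of an affine scheme along a finite free ring extension exists. -/
theorem exists_isUniversal_affine (k K A : Type u) [CommRing k] [CommRing K] [Algebra k K]
    [Module.Free k K] [Module.Finite k K] [CommRing A] [Algebra K A] :
    ∃ (W : Scheme.{u}) (x : Point (Spec.map (CommRingCat.ofHom (algebraMap k K)))
      (Spec.map (CommRingCat.ofHom (algebraMap K A))) W), x.IsUniversal := by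
  obtain ⟨R, _, _, Φ, hΦ⟩ := exists_algebra_restriction k K A
  refine ⟨Spec (CommRingCat.of R), Point.ofAlgHom Φ, Point.isUniversal_of_affine fun B ↦ ⟨?_, ?_⟩⟩
  · intro ψ ψ' h
    obtain ⟨ψ, rfl⟩ := Spec.map_surjective ψ
    obtain ⟨ψ', rfl⟩ := Spec.map_surjective ψ'
    -- `B` carries no `k`-structure beforehand. Equality of the structure morphisms of the two
    -- points shows that `ψ` and `ψ'` induce the same one, so both become `k`-algebra homomorphisms.
    let f : k →+* B := ψ.hom.comp (algebraMap k R)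
    have hf : f = ψ'.hom.comp (algebraMap k R) := by
      have : Spec.map ψ ≫ Spec.map (CommRingCat.ofHom (algebraMap k R)) =
        Spec.map ψ' ≫ Spec.map (CommRingCat.ofHom (algebraMap k R)) := congrArg Point.t h
      rw [← Spec.map_comp, ← Spec.map_comp] at this
      exact congrArg CommRingCat.Hom.hom (Spec.map_injective this)
    let := f.toAlgebra
    let ψ₁ : R →ₐ[k] B := { ψ.hom with commutes' := fun r ↦ rfl }
    let ψ₂ : R →ₐ[k] B := { ψ'.hom with commutes' := fun r ↦ congr($(hf.symm) r) }
    have e : ψ₁ = ψ₂ := (hΦ B _).unique rfl (Point.ofAlgHom_injective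
      ((Point.pull_ofAlgHom Φ ψ₂).symm.trans (h.symm.trans (Point.pull_ofAlgHom Φ ψ₁))))
    congr 1
    ext r
    exact congr($e r)
  · intro a
    obtain ⟨f, hf⟩ := Spec.map_surjective a.t
    let : Algebra k B := f.hom.toAlgebra
    obtain ⟨g, rfl⟩ := Point.exists_ofAlgHom (k := k) (B := B) a hf.symm
    obtain ⟨ψ, rfl, -⟩ := hΦ B g
    exact ⟨Spec.map (CommRingCat.ofHom ψ.toRingHom), Point.pull_ofAlgHom Φ ψ⟩

end WeilRes

/-! ### Finite sets of points lie in affine opens -/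

namespace WeilRes

section Avoidance

variable {A σ : Type*} [CommRing A] [SetLike σ A] [AddSubgroupClass σ A] {𝒜 : ℕ → σ}
  [GradedRing 𝒜]

/-- Some homogeneous component of a general basic open function avoids `x`. Multiplying by a
positive-degree element outside `x`, which exists since `x` is relevant, makes the degree positive,
as affineness of the basic open requires. -/
lemma ProjectiveSpectrum.exists_homogeneous_notMem_le (x : ProjectiveSpectrum 𝒜)
    {O : Set (ProjectiveSpectrum 𝒜)} (hO : IsOpen O) (hx : x ∈ O) :
    ∃ m, 0 < m ∧ ∃ f ∈ 𝒜 m, f ∉ x.asHomogeneousIdeal ∧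
      (ProjectiveSpectrum.basicOpen 𝒜 f : Set (ProjectiveSpectrum 𝒜)) ⊆ O := by
  obtain ⟨_, ⟨g, rfl⟩, hxg, hg⟩ :=
    (ProjectiveSpectrum.isTopologicalBasis_basic_opens 𝒜).exists_subset_of_mem_open hx hO
  obtain ⟨i, hi⟩ : ∃ i, GradedRing.proj 𝒜 i g ∉ x.asHomogeneousIdeal := by
    by_contra! h
    exact hxg ((x.asHomogeneousIdeal.isHomogeneous.mem_iff).2 h)
  obtain ⟨j, hj, e, he, hex⟩ : ∃ j, 0 < j ∧ ∃ e ∈ 𝒜 j, e ∉ x.asHomogeneousIdeal := by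
    by_contra! h
    refine x.not_irrelevant_le ?_
    exact (HomogeneousIdeal.toIdeal_irrelevant_le (I := x.asHomogeneousIdeal.toIdeal) 𝒜).2
      fun j hj e he ↦ h j hj e he
  refine ⟨i + j, by omega, GradedRing.proj 𝒜 i g * e,
    SetLike.mul_mem_graded (SetLike.coe_mem _) he, fun h ↦ ?_, ?_⟩
  · exact (x.isPrime.mem_or_mem h).elim hi hex
  · refine Set.Subset.trans ?_ hg
    refine Set.Subset.trans (ProjectiveSpectrum.basicOpen_mul_le_left 𝒜 _ e) ?_
    exact (le_iSup (fun i ↦ ProjectiveSpectrum.basicOpen 𝒜 (GradedRing.proj 𝒜 i g)) i).trans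
      (ProjectiveSpectrum.basicOpen_eq_union_of_projection 𝒜 g).ge

lemma ProjectiveSpectrum.exists_homogeneous_mem_notMem {x y : ProjectiveSpectrum 𝒜}
    (h : ¬ y ≤ x) : ∃ m, ∃ f ∈ 𝒜 m, f ∈ y.asHomogeneousIdeal ∧ f ∉ x.asHomogeneousIdeal := by
  by_contra! H
  refine h fun a ha ↦ ?_
  exact (x.asHomogeneousIdeal.isHomogeneous.mem_iff).2 fun i ↦
    H i _ (SetLike.coe_mem _) ((y.asHomogeneousIdeal.isHomogeneous.mem_iff).1 ha i)

/-- Homogeneous prime avoidance: a finite subset of an open subset `O` of the projective spectrum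
is contained in a basic open subset of `O`. -/
theorem ProjectiveSpectrum.exists_homogeneous_of_finset (O : Set (ProjectiveSpectrum 𝒜))
    (hO : IsOpen O) (s : Finset (ProjectiveSpectrum 𝒜)) (hs : (s : Set _) ⊆ O) :
    ∃ m, 0 < m ∧ ∃ f ∈ 𝒜 m, (∀ x ∈ s, f ∉ x.asHomogeneousIdeal) ∧
      (ProjectiveSpectrum.basicOpen 𝒜 f : Set (ProjectiveSpectrum 𝒜)) ⊆ O := by
  classical
  induction s using Finset.strongInduction with
  | H s ih =>
  obtain rfl | hne := s.eq_empty_or_nonempty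
  · exact ⟨1, one_pos, 0, ZeroMemClass.zero_mem _, by simp, by simp⟩
  -- Minimality of `x` ensures that no other prime of `s` is contained in it, so each of them has a
  -- homogeneous element outside `x`.
  obtain ⟨x, hxs, hx⟩ := s.exists_minimal hne
  obtain ⟨m, hm, f, hf, hfs, hfO⟩ := ih (s.erase x) (Finset.erase_ssubset hxs)
    fun y hy ↦ hs (Finset.mem_of_mem_erase hy)
  by_cases hfx : f ∈ x.asHomogeneousIdeal
  swap
  · refine ⟨m, hm, f, hf, fun y hy ↦ ?_, hfO⟩
    by_cases hyx : y = x
    · rwa [hyx]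
    · exact hfs y (Finset.mem_erase.2 ⟨hyx, hy⟩)
  obtain ⟨n, hn, g, hg, hgx, hgO⟩ := exists_homogeneous_notMem_le x hO (hs hxs)
  have hle (y : s.erase x) : ¬ y.1 ≤ x := fun h ↦
    (Finset.mem_erase.1 y.2).1 (le_antisymm h (hx (Finset.mem_of_mem_erase y.2) h))
  choose d h hhd hhy hhx using fun y : s.erase x ↦ exists_homogeneous_mem_notMem (hle y)
  -- `p` avoids `x` but lies in every other prime of `s`; the factor `g` keeps its basic open inside
  -- `O`.
  let p := g * ∏ y, h y
  let N := n + ∑ y, d y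
  have hpN : p ∈ 𝒜 N := SetLike.mul_mem_graded hg (SetLike.prod_mem_graded _ _ _ fun y _ ↦ hhd y)
  have hN : 0 < N := by omega
  have hpx : p ∉ x.asHomogeneousIdeal := fun H ↦
    (x.isPrime.mem_or_mem H).elim hgx fun H ↦ by
      obtain ⟨y, -, hy⟩ := (x.isPrime.prod_mem_iff).1 H
      exact hhx y hy
  have hpy (y) (hy : y ∈ s.erase x) : p ∈ y.asHomogeneousIdeal :=
    Ideal.mul_mem_left _ _ (Ideal.mem_of_dvd _ (Finset.dvd_prod_of_mem h (Finset.mem_univ ⟨y, hy⟩))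
      (hhy ⟨y, hy⟩))
  -- The exponents equalise degrees. When `f` lies in `x`, exactly one summand vanishes at each
  -- prime of `s`, so the sum vanishes at none.
  refine ⟨m * N, Nat.mul_pos hm hN, f ^ N + p ^ m,
    add_mem (by simpa [mul_comm] using SetLike.pow_mem_graded N hf)
      (by simpa using SetLike.pow_mem_graded m hpN), fun y hy H ↦ ?_, fun z hz ↦ ?_⟩
  · by_cases hyx : y = x
    · subst hyx
      exact hpx (y.isPrime.mem_of_pow_mem m ((Ideal.add_mem_iff_right _
        (Ideal.pow_mem_of_mem _ hfx N hN)).1 H))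
    · have hy' := Finset.mem_erase.2 ⟨hyx, hy⟩
      exact hfs y hy' (y.isPrime.mem_of_pow_mem N ((Ideal.add_mem_iff_left _
        (Ideal.pow_mem_of_mem _ (hpy y hy') m hm)).1 H))
  · by_cases hfz : f ∈ z.asHomogeneousIdeal
    · refine hgO fun hgz ↦ hz (Ideal.add_mem _ (Ideal.pow_mem_of_mem _ hfz N hN)
        (Ideal.pow_mem_of_mem _ (Ideal.mul_mem_right _ _ hgz) m hm))
    · exact hfO hfz

end Avoidance

/-- A finite set of points of a scheme which is immersed into `Proj` of a graded ring is contained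
in an affine open subset. -/
theorem exists_isAffineOpen_of_finite {A : Type u} {σ : Type*} [CommRing A] [SetLike σ A]
    [AddSubgroupClass σ A] (𝒜 : ℕ → σ) [GradedRing 𝒜] {X : Scheme.{u}} (e : X ⟶ Proj 𝒜)
    [IsImmersion e] {s : Set X} (hs : s.Finite) :
    ∃ U : X.Opens, IsAffineOpen U ∧ s ⊆ U := by
  classical
  obtain ⟨m, hm, f, hf, hfs, hfO⟩ := ProjectiveSpectrum.exists_homogeneous_of_finset (𝒜 := 𝒜)
    (e.coborderRange : Set (Proj 𝒜)) e.coborderRange.isOpen (hs.toFinset.image e) (by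
      intro y hy
      obtain ⟨x, -, rfl⟩ := Finset.mem_image.1 hy
      exact subset_coborder ⟨x, rfl⟩)
  have hD : IsAffineOpen (Proj.basicOpen 𝒜 f) := Proj.isAffineOpen_basicOpen 𝒜 f hf hm
  refine ⟨e ⁻¹ᵁ Proj.basicOpen 𝒜 f, ?_, fun x hx ↦ hfs _ (Finset.mem_image_of_mem e
    (hs.mem_toFinset.2 hx))⟩
  -- An immersion is closed in the open complement of its boundary. The basic open lies in that
  -- open, so its preimage under the closed immersion is affine.
  rw [← e.liftCoborder_ι, Scheme.Hom.comp_preimage]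
  refine IsAffineOpen.preimage (hD.preimage_of_isOpenImmersion _ ?_) _
  rw [Scheme.Opens.opensRange_ι]
  exact hfO

lemma IsQuasiProjective.exists_isAffineOpen {F : Type u} [Field F]
    {V : Over (Spec (CommRingCat.of F))} (hV : IsQuasiProjective V) {s : Set V.left}
    (hs : s.Finite) : ∃ U : V.left.Opens, IsAffineOpen U ∧ s ⊆ U := by
  obtain ⟨n, e, he⟩ := hV
  let := MvPolynomial.gradedAlgebra (σ := Fin (n + 1)) (R := F)
  let e' : V.left ⟶ Proj (MvPolynomial.homogeneousSubmodule (Fin (n + 1)) F) := e.left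
  have : IsImmersion e' := he
  exact exists_isAffineOpen_of_finite _ e' hs

end WeilRes

/-! ### Existence over a finite field extension -/

namespace WeilRes

lemma exists_isUniversal_of_isAffineOpen {k K : Type u} [CommRing k] [CommRing K] [Algebra k K]
    [Module.Free k K] [Module.Finite k K] {V : Scheme.{u}} (q : V ⟶ Spec (CommRingCat.of K))
    {U : V.Opens} (hU : IsAffineOpen U) :
    ∃ (W : Scheme.{u}) (x : Point (Spec.map (CommRingCat.ofHom (algebraMap k K)))
      (hU.fromSpec ≫ q) W), x.IsUniversal := by
  obtain ⟨φ, hφ⟩ := Spec.map_surjective (hU.fromSpec ≫ q)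
  let : Algebra K Γ(V, U) := φ.hom.toAlgebra
  rw [← hφ]
  exact exists_isUniversal_affine k K Γ(V, U)

/-- The Weil restriction along a finite extension of fields of a scheme in which finite sets of
points have affine neighbourhoods exists. -/
theorem exists_isUniversal_of_finite_subset_affine {k K : Type u} [Field k] [Field K] [Algebra k K]
    [FiniteDimensional k K] {V : Scheme.{u}} (q : V ⟶ Spec (CommRingCat.of K))
    (hV : ∀ s : Set V, s.Finite → ∃ U : V.Opens, IsAffineOpen U ∧ s ⊆ U) :
    ∃ (W : Scheme.{u}) (x : Point (Spec.map (CommRingCat.ofHom (algebraMap k K))) q W),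
      x.IsUniversal := by
  have hfin : IsFinite (Spec.map (CommRingCat.ofHom (algebraMap k K))) :=
    (IsFinite.SpecMap_iff _).2 (RingHom.finite_algebraMap.2 inferInstance)
  have (U : V.affineOpens) : IsOpenImmersion U.2.fromSpec := U.2.isOpenImmersion_fromSpec
  refine exists_isUniversal_of_cover (ι := V.affineOpens) (U := fun U ↦ Spec Γ(V, U.1))
    (fun U ↦ U.2.fromSpec) (fun U ↦ exists_isUniversal_of_isAffineOpen q U.2) fun T a t ↦ ?_
  -- The fibre over `t` is finite because `a.t` is paired with a finite morphism.
  obtain ⟨U, hU, hs⟩ := hV (a.g '' (pullback.fst a.t _ ⁻¹' {t}))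
    ((Scheme.Hom.finite_preimage_singleton _ t).image _)
  refine ⟨⟨U, hU⟩, fun z hz ↦ ?_⟩
  rw [hU.range_fromSpec]
  exact hs ⟨z, hz, rfl⟩

end WeilRes

/-! ### Splitting of `K` over `Ω` and disjoint unions -/

namespace WeilRes

open TensorProduct

section SplitAlgebra

variable (k K Ω : Type u) [Field k] [Field K] [Field Ω] [Algebra k K] [Algebra k Ω]

/-- The homomorphism `Ω ⊗[k] K → ∏ Ω` whose components are given by the `k`-homomorphisms
`K → Ω`. -/
noncomputable def tensorToPi : Ω ⊗[k] K →ₐ[Ω] ((K →ₐ[k] Ω) → Ω) :=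
  Algebra.TensorProduct.lift (Algebra.ofId Ω _) (AlgHom.pi fun τ : K →ₐ[k] Ω ↦ τ)
    fun _ _ ↦ Commute.all _ _

lemma tensorToPi_tmul (x : Ω) (y : K) (τ : K →ₐ[k] Ω) : tensorToPi k K Ω (x ⊗ₜ y) τ = x * τ y := by
  simp [tensorToPi, Algebra.ofId_apply]

variable [FiniteDimensional k K]

/-- A functional vanishing on the image would be a linear relation between the distinct embeddings
`K → Ω`, contradicting Dedekind's independence of characters. -/
lemma tensorToPi_surjective : Function.Surjective (tensorToPi k K Ω) := by
  classical
  let : Fintype (K →ₐ[k] Ω) := Fintype.ofFinite _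
  have htop : LinearMap.range (tensorToPi k K Ω).toLinearMap = ⊤ := by
    by_contra hne
    obtain ⟨f, hf, hle⟩ := Submodule.exists_le_ker_of_lt_top _ (lt_top_iff_ne_top.2 hne)
    refine hf (LinearMap.pi_ext' fun τ ↦ LinearMap.ext_ring ?_)
    have hli := Fintype.linearIndependent_iff.1 (linearIndependent_toLinearMap k K Ω)
      (fun τ ↦ f (Pi.single τ 1)) (LinearMap.ext fun y ↦ by
        have h0 : f (tensorToPi k K Ω (1 ⊗ₜ y)) = 0 := hle ⟨1 ⊗ₜ y, rfl⟩
        have hsum : tensorToPi k K Ω (1 ⊗ₜ y) = ∑ τ : K →ₐ[k] Ω, τ y • Pi.single τ (1 : Ω) := by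
          ext σ
          simp [tensorToPi_tmul, Finset.sum_apply, Pi.single_apply]
        rw [hsum, map_sum] at h0
        simpa [mul_comm] using h0)
    simpa using hli τ
  exact LinearMap.range_eq_top.1 htop

/-- Both sides have dimension `[K : k]`, since a separable extension split by `Ω` has that many
embeddings. -/
lemma tensorToPi_bijective [Algebra.IsSeparable k K]
    (hΩ : ∀ x : K, ((minpoly k x).map (algebraMap k Ω)).Splits) :
    Function.Bijective (tensorToPi k K Ω) := by
  let : Fintype (K →ₐ[k] Ω) := Fintype.ofFinite _
  refine ⟨?_, tensorToPi_surjective k K Ω⟩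
  refine (LinearMap.injective_iff_surjective_of_finrank_eq_finrank
    (f := (tensorToPi k K Ω).toLinearMap) ?_).2 (tensorToPi_surjective k K Ω)
  rw [Module.finrank_baseChange, Module.finrank_fintype_fun_eq_card, Fintype.card_eq_nat_card,
    AlgHom.natCard_of_splits k K Ω hΩ]

end SplitAlgebra

/-- Finite coproducts of schemes are stable under base change, and each `j i` is the base change of
`e i` along the induced morphism `p` to `Q`. -/
lemma nonempty_isColimit_cofan_pullback {S S' O Q T : Scheme.{u}} {s : S' ⟶ S} {r : O ⟶ S}
    {a : Q ⟶ O} {b : Q ⟶ S'} (hQ : IsPullback a b r s) {ι : Type u} [Finite ι] (e : ι → (O ⟶ Q))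
    (he : ∀ i, e i ≫ a = 𝟙 O) (hc : Nonempty (IsColimit (Cofan.mk Q e))) (t : T ⟶ O)
    (j : ι → (T ⟶ pullback (t ≫ r) s)) (hj : ∀ i, j i ≫ pullback.fst _ _ = 𝟙 T)
    (hj' : ∀ i, j i ≫ pullback.snd _ _ = t ≫ e i ≫ b) :
    Nonempty (IsColimit (Cofan.mk (pullback (t ≫ r) s) j)) := by
  let p : pullback (t ≫ r) s ⟶ Q := hQ.lift (pullback.fst _ _ ≫ t) (pullback.snd _ _)
    (by rw [Category.assoc, pullback.condition])
  have hpa : p ≫ a = pullback.fst _ _ ≫ t := hQ.lift_fst _ _ _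
  have hpb : p ≫ b = pullback.snd _ _ := hQ.lift_snd _ _ _
  have hp : IsPullback p (pullback.fst _ _) a t := by
    refine IsPullback.of_right (h₁₂ := b) (v₁₃ := s) (h₂₂ := r) ?_ hpa hQ.flip
    rw [hpb]
    exact (IsPullback.of_hasPullback _ _).flip
  have hjp (i) : j i ≫ p = t ≫ e i := by
    refine hQ.hom_ext ?_ ?_
    · rw [Category.assoc, hpa, ← Category.assoc, hj, Category.id_comp, Category.assoc, he,
        Category.comp_id]
    · rw [Category.assoc, hpb, hj', Category.assoc]
  have hpb (i) : IsPullback (j i) t p (e i) := by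
    refine IsPullback.flip (IsPullback.of_bot (v₂₁ := pullback.fst _ _) (v₂₂ := a)
      (h₃₁ := t) ?_ (hjp i).symm hp)
    rw [hj, he]
    exact IsPullback.of_vert_isIso ⟨by simp⟩
  obtain ⟨hc⟩ := hc
  refine FinitaryPreExtensive.isUniversal_finiteCoproducts hc (Cofan.mk _ j)
    (Discrete.natTrans fun _ ↦ t) p ?_ (NatTrans.Equifibered.of_discrete _) fun i ↦ hpb i.as
  ext i
  exact (hjp i.as).symm

/-- If `K/k` is split by `Ω`, then the base change to `K` of an `Ω`-scheme `T`, considered as a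
`k`-scheme, is the disjoint union of copies of `T` indexed by the `k`-homomorphisms `K → Ω`. -/
theorem nonempty_isColimit_cofan_of_splits (k K Ω : Type u) [Field k] [Field K] [Field Ω]
    [Algebra k K] [Algebra k Ω] [FiniteDimensional k K] [Algebra.IsSeparable k K]
    (hΩ : ∀ x : K, ((minpoly k x).map (algebraMap k Ω)).Splits) {T : Scheme.{u}}
    (t : T ⟶ Spec (CommRingCat.of Ω))
    (j : (K →ₐ[k] Ω) → (T ⟶ pullback (t ≫ Spec.map (CommRingCat.ofHom (algebraMap k Ω)))
      (Spec.map (CommRingCat.ofHom (algebraMap k K)))))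
    (hj : ∀ τ, j τ ≫ pullback.fst _ _ = 𝟙 T)
    (hj' : ∀ τ, j τ ≫ pullback.snd _ _ = t ≫ Spec.map (CommRingCat.ofHom τ.toRingHom)) :
    Nonempty (IsColimit (Cofan.mk _ j)) := by
  have hQ := isPullback_SpecMap_of_isPushout _ _ _ _ (CommRingCat.isPushout_tensorProduct k Ω K)
  let ev (τ : K →ₐ[k] Ω) : Ω ⊗[k] K →+* Ω := (Pi.evalRingHom _ τ).comp (tensorToPi k K Ω).toRingHom
  refine nonempty_isColimit_cofan_pullback hQ
    (fun τ ↦ Spec.map (CommRingCat.ofHom (ev τ))) (fun τ ↦ ?_) ?_ t j hj fun τ ↦ ?_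
  · rw [← Spec.map_comp, ← CommRingCat.ofHom_comp, ← Spec.map_id]
    congr 1
    ext x
    change tensorToPi k K Ω (x ⊗ₜ 1) τ = x
    rw [tensorToPi_tmul, map_one, mul_one]
  · rw [Cofan.nonempty_isColimit_iff_isIso_sigmaDesc]
    let E : CommRingCat.of (Ω ⊗[k] K) ≅ CommRingCat.of ((K →ₐ[k] Ω) → Ω) :=
      (RingEquiv.ofBijective (tensorToPi k K Ω).toRingHom
        (tensorToPi_bijective k K Ω hΩ)).toCommRingCatIso
    have : Sigma.desc (Cofan.inj (Cofan.mk _ fun τ ↦ Spec.map (CommRingCat.ofHom (ev τ)))) =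
        sigmaSpec (fun _ : K →ₐ[k] Ω ↦ CommRingCat.of Ω) ≫ Spec.map E.hom := by
      refine Sigma.hom_ext _ _ fun τ ↦ ?_
      rw [Sigma.ι_desc, ← Category.assoc, ι_sigmaSpec, ← Spec.map_comp]
      rfl
    rw [this]
    infer_instance
  · rw [hj', ← Spec.map_comp, ← CommRingCat.ofHom_comp]
    congr 3
    ext y
    change τ y = tensorToPi k K Ω (1 ⊗ₜ y) τ
    rw [tensorToPi_tmul, one_mul]

end WeilRes

/-! ### Universal property and comparison with the conjugates -/

namespace WeilRes

section

variable {F L M : Type u} [Field F] [Field L] [Field M]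

lemma ext_baseChange {i : F →+* L}
    {V : Over (Spec (CommRingCat.of F))} {T : Over (Spec (CommRingCat.of L))}
    {f g : T ⟶ (baseChange i).obj V}
    (h : f.left ≫ pullback.fst V.hom (Spec.map (CommRingCat.ofHom i)) =
      g.left ≫ pullback.fst V.hom (Spec.map (CommRingCat.ofHom i))) : f = g := by
  ext1
  exact pullback.hom_ext h ((Over.w f).trans (Over.w g).symm)

lemma baseChange_map_left_fst (i : F →+* L) {V V' : Over (Spec (CommRingCat.of F))} (f : V ⟶ V') :
    ((baseChange i).map f).left ≫ pullback.fst V'.hom (Spec.map (CommRingCat.ofHom i)) =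
      pullback.fst V.hom (Spec.map (CommRingCat.ofHom i)) ≫ f.left :=
  pullback.lift_fst _ _ _

lemma baseChangeComp_inv_left_fst_fst (i : F →+* L) (j : L →+* M) (l : F →+* M)
    (h : j.comp i = l) (V : Over (Spec (CommRingCat.of F))) :
    (baseChangeComp i j l h V).inv.left ≫
        pullback.fst (pullback.snd V.hom (Spec.map (CommRingCat.ofHom i)))
          (Spec.map (CommRingCat.ofHom j)) ≫
        pullback.fst V.hom (Spec.map (CommRingCat.ofHom i)) =
      pullback.fst V.hom (Spec.map (CommRingCat.ofHom l)) := by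
  have h₁ : (baseChangeComp i j l h V).inv.left ≫ (baseChangeComp i j l h V).hom.left = 𝟙 _ :=
    congrArg CommaMorphism.left (baseChangeComp i j l h V).inv_hom_id
  rw [← baseChangeComp_hom_left_fst i j l h V]
  refine (Category.assoc _ _ _).symm.trans ?_
  rw [h₁]
  exact Category.id_comp _

lemma baseChangeComp_inv_left_fst_snd (i : F →+* L) (j : L →+* M) (l : F →+* M)
    (h : j.comp i = l) (V : Over (Spec (CommRingCat.of F))) :
    (baseChangeComp i j l h V).inv.left ≫
        pullback.fst (pullback.snd V.hom (Spec.map (CommRingCat.ofHom i)))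
          (Spec.map (CommRingCat.ofHom j)) ≫
        pullback.snd V.hom (Spec.map (CommRingCat.ofHom i)) =
      pullback.snd V.hom (Spec.map (CommRingCat.ofHom l)) ≫ Spec.map (CommRingCat.ofHom j) := by
  have h₁ : (baseChangeComp i j l h V).inv.left ≫
      pullback.snd (pullback.snd V.hom (Spec.map (CommRingCat.ofHom i)))
          (Spec.map (CommRingCat.ofHom j)) = pullback.snd V.hom (Spec.map (CommRingCat.ofHom l)) :=
    Over.w (baseChangeComp i j l h V).inv
  rw [pullback.condition, ← h₁]
  exact (Category.assoc _ _ _).symm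

end

section

variable {k K : Type u} [Field k] [Field K] [Algebra k K]

/-- `(W, φ)` satisfies the universal property of the Weil restriction with respect to all
`k`-schemes. -/
def IsRepresenting (V : Over (Spec (CommRingCat.of K))) (W : Over (Spec (CommRingCat.of k)))
    (φ : (baseChange (algebraMap k K)).obj W ⟶ V) : Prop :=
  ∀ (T : Over (Spec (CommRingCat.of k))) (φ' : (baseChange (algebraMap k K)).obj T ⟶ V),
    ∃! ψ : T ⟶ W, (baseChange (algebraMap k K)).map ψ ≫ φ = φ'

lemma Point.IsUniversal.isRepresenting {V : Over (Spec (CommRingCat.of K))} {W : Scheme.{u}}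
    {x : Point (Spec.map (CommRingCat.ofHom (algebraMap k K))) V.hom W} (hx : x.IsUniversal) :
    IsRepresenting V (Over.mk x.t) (Over.homMk x.g x.w) := by
  intro T φ'
  have key (ψ : T ⟶ Over.mk x.t) : (baseChange (algebraMap k K)).map ψ ≫
      (Over.homMk x.g x.w : _ ⟶ V) = φ' ↔ x.pull ψ.left = ⟨T.hom, φ'.left, Over.w φ'⟩ := by
    have hψ : ψ.left ≫ x.t = T.hom := Over.w ψ
    constructor
    · rintro rfl
      refine ext_ev hψ fun Z a b h₁ h₂ ↦ ?_
      refine (pull_ev _ _ _ _ h₁).trans (Eq.trans ?_ (Category.assoc _ _ _))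
      refine congrArg (· ≫ x.g) (pullback.hom_ext ?_ ?_)
      · refine (pullback.lift_fst _ _ _).trans (Eq.symm ?_)
        refine (Category.assoc _ _ _).trans ((congrArg _ (pullback.lift_fst _ _ _)).trans ?_)
        exact (Category.assoc _ _ _).symm.trans (congrArg (· ≫ ψ.left) (pullback.lift_fst _ _ _))
      · refine (pullback.lift_snd _ _ _).trans (Eq.symm ?_)
        refine (Category.assoc _ _ _).trans ((congrArg _ (pullback.lift_snd _ _ _)).trans ?_)
        exact pullback.lift_snd _ _ _
    · intro h
      ext1
      have e : pullback.fst T.hom (Spec.map (CommRingCat.ofHom (algebraMap k K))) ≫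
          (x.pull ψ.left).t = pullback.snd _ _ ≫
            Spec.map (CommRingCat.ofHom (algebraMap k K)) := by
        rw [h]; exact pullback.condition
      have := ev_congr h rfl rfl e
      rw [pull_ev] at this
      exact this.trans (ev_fst_snd _)
  obtain ⟨ψ, hψ, huniq⟩ := (hx T.left).existsUnique ⟨T.hom, φ'.left, Over.w φ'⟩
  refine ⟨Over.homMk ψ (congrArg Point.t hψ), (key _).2 hψ, fun ψ' h ↦ ?_⟩
  ext1
  exact huniq _ ((key _).1 h)

/-- The Weil restriction of a quasi-projective scheme exists. -/
theorem exists_isRepresenting [FiniteDimensional k K] (V : Over (Spec (CommRingCat.of K)))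
    (hV : IsQuasiProjective V) : ∃ W φ, IsRepresenting (k := k) V W φ := by
  obtain ⟨W, x, hx⟩ := exists_isUniversal_of_finite_subset_affine (k := k) V.hom
    fun s hs ↦ hV.exists_isAffineOpen hs
  exact ⟨_, _, hx.isRepresenting⟩

end

section

variable {k K Ω : Type u} [Field k] [Field K] [Field Ω] [Algebra k K] [Algebra k Ω]
  [FiniteDimensional k K] {V : Over (Spec (CommRingCat.of K))} {W : Over (Spec (CommRingCat.of k))}

/-- The morphism from the base change of the Weil restriction to the product of the conjugates. -/
noncomputable def toConjProd (Ω : Type u) [Field Ω] [Algebra k Ω]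
    (φ : (baseChange (algebraMap k K)).obj W ⟶ V) :
    (baseChange (algebraMap k Ω)).obj W ⟶ conjProd k Ω V :=
  Pi.lift fun τ ↦
    (baseChangeComp (algebraMap k K) τ.toRingHom (algebraMap k Ω) τ.comp_algebraMap W).inv ≫
      (baseChange τ.toRingHom).map φ

lemma toConjProd_π (φ : (baseChange (algebraMap k K)).obj W ⟶ V) (τ : K →ₐ[k] Ω) :
    toConjProd Ω φ ≫ conjProdπ V τ =
      (baseChangeComp (algebraMap k K) τ.toRingHom (algebraMap k Ω) τ.comp_algebraMap W).inv ≫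
        (baseChange τ.toRingHom).map φ :=
  Pi.lift_π _ _

/-- The section over `τ : K → Ω` of the base change to `K` of an `Ω`-scheme. -/
noncomputable def splitSection (T : Over (Spec (CommRingCat.of Ω))) (τ : K →ₐ[k] Ω) :
    T.left ⟶ pullback (T.hom ≫ Spec.map (CommRingCat.ofHom (algebraMap k Ω)))
      (Spec.map (CommRingCat.ofHom (algebraMap k K))) :=
  pullback.lift (𝟙 _) (T.hom ≫ Spec.map (CommRingCat.ofHom τ.toRingHom)) (by
    rw [Category.id_comp, Category.assoc, ← Spec.map_comp, ← CommRingCat.ofHom_comp]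
    congr 3
    exact τ.comp_algebraMap.symm)

/-- The `k`-morphism to `W` corresponding to an `Ω`-morphism to its base change. -/
noncomputable def restrictHom {T : Over (Spec (CommRingCat.of Ω))}
    (v : T ⟶ (baseChange (algebraMap k Ω)).obj W) :
    Over.mk (T.hom ≫ Spec.map (CommRingCat.ofHom (algebraMap k Ω))) ⟶ W :=
  Over.homMk (v.left ≫ pullback.fst W.hom (Spec.map (CommRingCat.ofHom (algebraMap k Ω)))) (by
    have h : v.left ≫ pullback.snd W.hom (Spec.map (CommRingCat.ofHom (algebraMap k Ω))) = T.hom :=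
      Over.w v
    change _ = T.hom ≫ _
    rw [Category.assoc, pullback.condition, ← h, Category.assoc])

lemma restrictHom_injective {T : Over (Spec (CommRingCat.of Ω))} :
    Function.Injective (restrictHom : (T ⟶ (baseChange (algebraMap k Ω)).obj W) → _) := by
  intro v v' h
  ext1
  exact pullback.hom_ext (congrArg CommaMorphism.left h) ((Over.w v).trans (Over.w v').symm)

lemma restrictHom_surjective {T : Over (Spec (CommRingCat.of Ω))} :
    Function.Surjective (restrictHom : (T ⟶ (baseChange (algebraMap k Ω)).obj W) → _) := by
  intro ψ
  refine ⟨Over.homMk (pullback.lift ψ.left T.hom (Over.w ψ)) (pullback.lift_snd _ _ _), ?_⟩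
  ext1
  exact pullback.lift_fst _ _ _

/-- The link between the two universal properties: the `τ`-component of `v`, read in `V`, is the
restriction to the `τ`-th copy of `T` of the `K`-morphism corresponding to `v`. -/
lemma comp_toConjProd_π (φ : (baseChange (algebraMap k K)).obj W ⟶ V)
    {T : Over (Spec (CommRingCat.of Ω))} (v : T ⟶ (baseChange (algebraMap k Ω)).obj W)
    (τ : K →ₐ[k] Ω) :
    (v ≫ toConjProd Ω φ ≫ conjProdπ V τ).left ≫ pullback.fst V.hom _ =
      splitSection T τ ≫ ((baseChange (algebraMap k K)).map (restrictHom v) ≫ φ).left := by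
  rw [toConjProd_π]
  have h₃ := baseChangeComp_inv_left_fst_fst (algebraMap k K) τ.toRingHom (algebraMap k Ω)
    τ.comp_algebraMap W
  have h₃' := baseChangeComp_inv_left_fst_snd (algebraMap k K) τ.toRingHom (algebraMap k Ω)
    τ.comp_algebraMap W
  set bi := (baseChangeComp (algebraMap k K) τ.toRingHom (algebraMap k Ω) τ.comp_algebraMap W).inv
  change (v.left ≫ bi.left ≫ ((baseChange τ.toRingHom).map φ).left) ≫ _ = splitSection T τ ≫
    ((baseChange (algebraMap k K)).map (restrictHom v)).left ≫ φ.left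
  simp only [Category.assoc]
  rw [baseChange_map_left_fst]
  have key : v.left ≫ bi.left ≫ pullback.fst (pullback.snd W.hom _) _ =
      splitSection T τ ≫ ((baseChange (algebraMap k K)).map (restrictHom v)).left := by
    refine pullback.hom_ext ?_ ?_
    · have h₁ : ((baseChange (algebraMap k K)).map (restrictHom v)).left ≫ pullback.fst _ _ =
        pullback.fst _ _ ≫ v.left ≫ pullback.fst _ _ := baseChange_map_left_fst _ (restrictHom v)
      have h₂ : splitSection T τ ≫ pullback.fst
          (Over.mk (T.hom ≫ Spec.map (CommRingCat.ofHom (algebraMap k Ω)))).hom _ = 𝟙 _ :=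
        pullback.lift_fst _ _ _
      simp only [Category.assoc]
      rw [h₁, reassoc_of% h₂, h₃]
    · have h₁ : ((baseChange (algebraMap k K)).map (restrictHom v)).left ≫ pullback.snd _ _ =
        pullback.snd _ _ := pullback.lift_snd _ _ _
      have h₂ : splitSection T τ ≫ pullback.snd
          (Over.mk (T.hom ≫ Spec.map (CommRingCat.ofHom (algebraMap k Ω)))).hom _ = T.hom ≫ _ :=
        pullback.lift_snd _ _ _
      have h₄ : v.left ≫ pullback.snd _ _ = T.hom := Over.w v
      simp only [Category.assoc]
      rw [h₁, h₂, h₃', reassoc_of% h₄]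
  exact (Category.assoc _ _ _).symm.trans ((Category.assoc _ _ _).symm.trans
    ((congrArg (· ≫ φ.left) ((Category.assoc _ _ _).trans key)).trans (Category.assoc _ _ _)))

lemma conjProd_hom_ext {T : Over (Spec (CommRingCat.of Ω))} {f g : T ⟶ conjProd k Ω V}
    (h : ∀ τ, f ≫ conjProdπ V τ = g ≫ conjProdπ V τ) : f = g :=
  Pi.hom_ext _ _ h

/-- By Yoneda: a morphism from `T` to the product is a family of maps `T → V` lying over the various
`τ`, hence one `K`-morphism from the disjoint union of copies of `T`. -/
theorem isIso_toConjProd [Algebra.IsSeparable k K]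
    {φ : (baseChange (algebraMap k K)).obj W ⟶ V} (hφ : IsRepresenting V W φ)
    (hΩ : ∀ x : K, ((minpoly k x).map (algebraMap k Ω)).Splits) :
    IsIso (toConjProd Ω φ) := by
  rw [isIso_iff_yoneda_map_bijective]
  intro T
  obtain ⟨hc⟩ := nonempty_isColimit_cofan_of_splits k K Ω hΩ T.hom (splitSection T)
    (fun τ ↦ pullback.lift_fst _ _ _) (fun τ ↦ pullback.lift_snd _ _ _)
  -- `T` viewed over `k` need not be of finite type, which is why representability on all
  -- `k`-schemes is used.
  let T₀ : Over (Spec (CommRingCat.of k)) :=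
    Over.mk (T.hom ≫ Spec.map (CommRingCat.ofHom (algebraMap k Ω)))
  refine ⟨fun v v' h ↦ restrictHom_injective ((hφ T₀ _).unique rfl ?_), fun w ↦ ?_⟩
  · ext1
    refine Cofan.IsColimit.hom_ext hc _ _ fun τ ↦ ?_
    have h' : v ≫ toConjProd Ω φ = v' ≫ toConjProd Ω φ := h
    refine (comp_toConjProd_π φ v' τ).symm.trans (Eq.trans ?_ (comp_toConjProd_π φ v τ))
    rw [← Category.assoc, ← Category.assoc, h']
  · let γ (τ : K →ₐ[k] Ω) : T.left ⟶ V.left := (w ≫ conjProdπ V τ).left ≫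
      pullback.fst V.hom (Spec.map (CommRingCat.ofHom τ.toRingHom))
    have hγ (τ) : γ τ ≫ V.hom = T.hom ≫ Spec.map (CommRingCat.ofHom τ.toRingHom) := by
      have h : (w ≫ conjProdπ V τ).left ≫
        pullback.snd V.hom (Spec.map (CommRingCat.ofHom τ.toRingHom)) = T.hom := Over.w _
      simp only [γ]
      rw [Category.assoc, pullback.condition, ← Category.assoc, h]
    let g : pullback (T.hom ≫ Spec.map (CommRingCat.ofHom (algebraMap k Ω)))
      (Spec.map (CommRingCat.ofHom (algebraMap k K))) ⟶ V.left := Cofan.IsColimit.desc hc γ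
    have hg (τ) : splitSection T τ ≫ g = γ τ := Cofan.IsColimit.fac hc γ τ
    have hgV : g ≫ V.hom = pullback.snd _ _ := Cofan.IsColimit.hom_ext hc _ _ fun τ ↦ by
      change splitSection T τ ≫ _ = splitSection T τ ≫ _
      rw [← Category.assoc, hg, hγ]
      exact (pullback.lift_snd _ _ _).symm
    let φ' : (baseChange (algebraMap k K)).obj T₀ ⟶ V := Over.homMk g hgV
    obtain ⟨ψ, hψ, -⟩ := hφ T₀ φ'
    obtain ⟨v, rfl⟩ := restrictHom_surjective ψ
    refine ⟨v, conjProd_hom_ext fun τ ↦ ext_baseChange ?_⟩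
    change ((v ≫ toConjProd Ω φ) ≫ conjProdπ V τ).left ≫ _ = _
    rw [Category.assoc]
    refine (comp_toConjProd_π φ v τ).trans ?_
    rw [hψ]
    exact hg τ

end

end WeilRes

/-! ### The canonical descent system and its splitting -/

namespace WeilRes

section

variable {F L M N : Type u} [Field F] [Field L] [Field M] [Field N]

lemma baseChangeComp_naturality (i : F →+* L) (j : L →+* M) (l : F →+* M) (h : j.comp i = l)
    {V V' : Over (Spec (CommRingCat.of F))} (f : V ⟶ V') :
    (baseChange j).map ((baseChange i).map f) ≫ (baseChangeComp i j l h V').hom =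
      (baseChangeComp i j l h V).hom ≫ (baseChange l).map f := by
  apply ext_baseChange
  have h₁ := baseChange_map_left_fst j ((baseChange i).map f)
  have h₂ := baseChange_map_left_fst i f
  have h₃ := baseChange_map_left_fst l f
  have h₄ := baseChangeComp_hom_left_fst i j l h V
  have h₅ := baseChangeComp_hom_left_fst i j l h V'
  refine (Category.assoc _ _ _).trans ((congrArg _ h₅).trans ?_)
  refine (Category.assoc _ _ _).symm.trans ((congrArg (· ≫ _) h₁).trans ?_)
  refine (Category.assoc _ _ _).trans ((congrArg _ h₂).trans ?_)
  refine ((Category.assoc _ _ _).symm.trans (congrArg (· ≫ f.left) h₄.symm)).trans ?_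
  exact ((Category.assoc _ _ _).trans (congrArg _ h₃.symm)).trans (Category.assoc _ _ _).symm

lemma baseChangeComp_assoc (i : F →+* L) (j : L →+* M) (m : M →+* N) (ij : F →+* M)
    (jm : L →+* N) (l : F →+* N) (h : j.comp i = ij) (h' : m.comp j = jm) (h₁ : m.comp ij = l)
    (h₂ : jm.comp i = l) (V : Over (Spec (CommRingCat.of F))) :
    (baseChange m).map (baseChangeComp i j ij h V).hom ≫ (baseChangeComp ij m l h₁ V).hom =
      (baseChangeComp j m jm h' ((baseChange i).obj V)).hom ≫
        (baseChangeComp i jm l h₂ V).hom := by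
  apply ext_baseChange
  have e₁ := baseChangeComp_hom_left_fst ij m l h₁ V
  have e₂ := baseChange_map_left_fst m (baseChangeComp i j ij h V).hom
  have e₃ := baseChangeComp_hom_left_fst i j ij h V
  have e₄ := baseChangeComp_hom_left_fst i jm l h₂ V
  have e₅ := baseChangeComp_hom_left_fst j m jm h' ((baseChange i).obj V)
  refine (Category.assoc _ _ _).trans ((congrArg _ e₁).trans ?_)
  refine (Category.assoc _ _ _).symm.trans ((congrArg (· ≫ _) e₂).trans ?_)
  refine (Category.assoc _ _ _).trans ((congrArg _ e₃).trans ?_)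
  refine (Category.assoc _ _ _).symm.trans (Eq.trans ?_ (Category.assoc _ _ _).symm)
  refine Eq.trans (congrArg (· ≫ _) e₅.symm) ?_
  exact (Category.assoc _ _ _).trans (congrArg _ e₄.symm)

end

section

variable {k Ω : Type u} [Field k] [Field Ω] [Algebra k Ω]

/-- A coboundary is a cocycle: in the composite, `σ(m⁻¹)` cancels `σm`, and the canonical
isomorphisms are coherent. -/
lemma IsSplitBy.isDescentSystem {V : Over (Spec (CommRingCat.of Ω))}
    {φ : ∀ σ : Ω ≃ₐ[k] Ω, (baseChange (galHom σ)).obj V ⟶ V}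
    {V₀ : Over (Spec (CommRingCat.of k))} {m : V ≅ (baseChange (algebraMap k Ω)).obj V₀}
    (hm : IsSplitBy V φ V₀ m) : IsDescentSystem V φ where
  isIso σ := by
    rw [hm σ]
    infer_instance
  cocycle σ τ := by
    rw [hm σ, hm τ, hm (σ * τ), Functor.map_comp, Functor.map_comp]
    have h₁ := baseChangeComp_naturality (galHom τ) (galHom σ) (galHom (σ * τ)) rfl m.hom
    have h₂ := baseChangeComp_assoc (algebraMap k Ω) (galHom τ) (galHom σ) (algebraMap k Ω)
      (galHom (σ * τ)) (algebraMap k Ω) (RingHom.ext fun x ↦ τ.commutes x) rfl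
      (RingHom.ext fun x ↦ σ.commutes x) (RingHom.ext fun x ↦ (σ * τ).commutes x) V₀
    have h₃ : (baseChange (galHom σ)).map m.inv ≫ (baseChange (galHom σ)).map m.hom = 𝟙 _ := by
      rw [← Functor.map_comp, m.inv_hom_id, CategoryTheory.Functor.map_id]
    simp only [Category.assoc]
    rw [reassoc_of% h₃, reassoc_of% h₂, reassoc_of% h₁]

end

section

variable {k K Ω : Type u} [Field k] [Field K] [Field Ω] [Algebra k K] [Algebra k Ω]
  [FiniteDimensional k K] {V : Over (Spec (CommRingCat.of K))}
  {W : Over (Spec (CommRingCat.of k))}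

/-- On the component at `ρ = στ`, both sides reduce to the identity `σ(τφ) = ρφ`, up to the
canonical isomorphisms. -/
lemma isSplitBy_toConjProd {φ : (baseChange (algebraMap k K)).obj W ⟶ V}
    {m : conjProd k Ω V ≅ (baseChange (algebraMap k Ω)).obj W} (hm : m.inv = toConjProd Ω φ) :
    IsSplitBy (conjProd k Ω V) (conjProdDescent V) W m := by
  intro σ
  refine conjProd_hom_ext fun ρ ↦ ?_
  set τ : K →ₐ[k] Ω := (σ.symm : Ω →ₐ[k] Ω).comp ρ with hτ
  have h : (galHom σ).comp τ.toRingHom = ρ.toRingHom :=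
    RingHom.ext fun x ↦ σ.apply_symm_apply (ρ x)
  have e₁ : conjProdDescent V σ ≫ conjProdπ V ρ =
      (baseChange (galHom σ)).map (conjProdπ V τ) ≫
        (baseChangeComp τ.toRingHom (galHom σ) ρ.toRingHom h V).hom := Pi.lift_π _ _
  have e₂ : conjProdπ V τ = m.hom ≫
      (baseChangeComp (algebraMap k K) τ.toRingHom (algebraMap k Ω) τ.comp_algebraMap W).inv ≫
        (baseChange τ.toRingHom).map φ := by
    rw [← toConjProd_π, ← hm, Iso.hom_inv_id_assoc]
  have e₃ := baseChangeComp_naturality τ.toRingHom (galHom σ) ρ.toRingHom h φ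
  have e₄ := baseChangeComp_assoc (algebraMap k K) τ.toRingHom (galHom σ) (algebraMap k Ω)
    ρ.toRingHom (algebraMap k Ω) τ.comp_algebraMap h (RingHom.ext fun x ↦ σ.commutes x)
    ρ.comp_algebraMap W
  have e₅ : (baseChange (galHom σ)).map
      (baseChangeComp (algebraMap k K) τ.toRingHom (algebraMap k Ω) τ.comp_algebraMap W).inv ≫
      (baseChangeComp τ.toRingHom (galHom σ) ρ.toRingHom h
        ((baseChange (algebraMap k K)).obj W)).hom =
      (baseChangeComp (algebraMap k Ω) (galHom σ) (algebraMap k Ω)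
        (RingHom.ext fun x ↦ σ.commutes x) W).hom ≫
      (baseChangeComp (algebraMap k K) ρ.toRingHom (algebraMap k Ω) ρ.comp_algebraMap W).inv := by
    rw [Iso.eq_comp_inv, Category.assoc, ← e₄, ← Functor.map_comp_assoc, Iso.inv_hom_id,
      CategoryTheory.Functor.map_id]
    exact Category.id_comp _
  rw [e₁, e₂, Functor.map_comp, Functor.map_comp]
  simp only [Category.assoc]
  rw [e₃, reassoc_of% e₅, hm, toConjProd_π]

end

/-! ### Descent of separatedness and finite type -/

section

variable {F L : Type u} [Field F] [Field L]

lemma morphismProperty_hom_of_iso (P : MorphismProperty Scheme.{u}) [P.IsStableUnderBaseChange]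
    {S : Scheme.{u}} {X Y : Over S} (e : X ≅ Y) (h : P X.hom) : P Y.hom :=
  (P.over_iso_iff e).1 h

/-- The structure morphism of a binary product over `S` is a base change of one factor's followed by
the other's. -/
lemma morphismProperty_pi_hom (P : MorphismProperty Scheme.{u}) [P.IsMultiplicative]
    [P.IsStableUnderBaseChange] {S : Scheme.{u}} [HasFiniteProducts (Over S)] {J : Type u}
    [Finite J] {f : J → Over S} (h : ∀ j, P (f j).hom) : P (∏ᶜ f).hom := by
  have : (P.overObj (X := S)).IsClosedUnderBinaryProducts := ⟨by
    rintro X ⟨p⟩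
    let c : BinaryFan (p.diag.obj ⟨.left⟩) (p.diag.obj ⟨.right⟩) :=
      BinaryFan.mk (p.π.app ⟨.left⟩) (p.π.app ⟨.right⟩)
    have hc : IsLimit c := (IsLimit.equivOfNatIsoOfIso (diagramIsoPair p.diag) (Cone.mk _ p.π) c
      (Cone.ext (Iso.refl _) (by
        rintro ⟨_ | _⟩
        · exact (Category.comp_id _).trans (Category.id_comp _).symm
        · exact (Category.comp_id _).trans (Category.id_comp _).symm))) p.isLimit
    have h := Over.isPullback_of_binaryFan_isLimit c hc
    have h' : P (c.fst.left ≫ (p.diag.obj ⟨.left⟩).hom) :=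
      P.comp_mem _ _ (P.of_isPullback h.flip (p.prop_diag_obj ⟨.right⟩)) (p.prop_diag_obj ⟨.left⟩)
    have hw : c.fst.left ≫ (p.diag.obj ⟨.left⟩).hom = X.hom := Over.w c.fst
    rw [hw] at h'
    exact h'⟩
  have : (P.overObj (X := S)).IsClosedUnderFiniteProducts := .mk'
  exact P.overObj.prop_product h

lemma morphismProperty_diagonal_of_pullback_snd (P Q₁ Q₂ Q₃ : MorphismProperty Scheme.{u})
    [P.IsStableUnderBaseChange] [Q₁.IsStableUnderBaseChange] [Q₂.IsStableUnderBaseChange]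
    [Q₃.IsStableUnderBaseChange] [P.DescendsAlong (Q₁ ⊓ Q₂ ⊓ Q₃)] {X Y Z : Scheme.{u}}
    {f : X ⟶ Y} {g : Z ⟶ Y} (h₁ : Q₁ g) (h₂ : Q₂ g) (h₃ : Q₃ g)
    (h : P (pullback.diagonal (pullback.snd f g))) : P (pullback.diagonal f) :=
  MorphismProperty.of_pullback_snd_of_descendsAlong (P := P.diagonal) (Q := Q₁ ⊓ Q₂ ⊓ Q₃)
    ⟨⟨h₁, h₂⟩, h₃⟩ h

lemma isSeparated_of_pullback_snd {X Y Z : Scheme.{u}} {f : X ⟶ Y} {g : Z ⟶ Y}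
    [Surjective g] [Flat g] [QuasiCompact g] (h : IsSeparated (pullback.snd f g)) :
    IsSeparated f := by
  have h₁ : UniversallyClosed (pullback.diagonal f) :=
    morphismProperty_diagonal_of_pullback_snd @UniversallyClosed @Surjective @Flat @QuasiCompact
      (g := g) ‹_› ‹_› ‹_› (inferInstance : UniversallyClosed (pullback.diagonal _))
  -- The diagonal is already a preimmersion, so only closedness of its image had to descend.
  exact ⟨.of_isPreimmersion _ (pullback.diagonal f).isClosedMap.isClosed_range⟩

lemma IsAlgebraicScheme.baseChange {V : Over (Spec (CommRingCat.of F))} (hV : IsAlgebraicScheme V)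
    (i : F →+* L) : IsAlgebraicScheme ((WeilRes.baseChange i).obj V) := by
  obtain ⟨h₁, h₂, h₃⟩ := hV
  exact ⟨inferInstanceAs (IsSeparated (pullback.snd V.hom (Spec.map (CommRingCat.ofHom i)))),
    inferInstanceAs (LocallyOfFiniteType (pullback.snd V.hom (Spec.map (CommRingCat.ofHom i)))),
    inferInstanceAs (QuasiCompact (pullback.snd V.hom (Spec.map (CommRingCat.ofHom i))))⟩

lemma IsAlgebraicScheme.of_iso {V V' : Over (Spec (CommRingCat.of F))} (hV : IsAlgebraicScheme V)
    (e : V ≅ V') : IsAlgebraicScheme V' where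
  isSeparated := morphismProperty_hom_of_iso @IsSeparated e hV.isSeparated
  locallyOfFiniteType :=
    morphismProperty_hom_of_iso @LocallyOfFiniteType e hV.locallyOfFiniteType
  quasiCompact := morphismProperty_hom_of_iso @QuasiCompact e hV.quasiCompact

lemma IsAlgebraicScheme.pi {J : Type u} [Finite J] {f : J → Over (Spec (CommRingCat.of F))}
    (h : ∀ j, IsAlgebraicScheme (f j)) : IsAlgebraicScheme (∏ᶜ f) where
  isSeparated := morphismProperty_pi_hom @IsSeparated fun j ↦ (h j).isSeparated
  locallyOfFiniteType :=
    morphismProperty_pi_hom @LocallyOfFiniteType fun j ↦ (h j).locallyOfFiniteType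
  quasiCompact := morphismProperty_pi_hom @QuasiCompact fun j ↦ (h j).quasiCompact

lemma IsAlgebraicScheme.of_baseChange {V : Over (Spec (CommRingCat.of F))} (i : F →+* L)
    (h : IsAlgebraicScheme ((WeilRes.baseChange i).obj V)) : IsAlgebraicScheme V := by
  have hf : Flat (Spec.map (CommRingCat.ofHom i)) :=
    Flat.SpecMap_iff.2 (@Module.Flat.of_projective F L _ _ i.toAlgebra.toModule inferInstance)
  have hs : Surjective (Spec.map (CommRingCat.ofHom i)) := ⟨Function.surjective_to_subsingleton _⟩
  refine ⟨isSeparated_of_pullback_snd (f := V.hom) (g := Spec.map (CommRingCat.ofHom i))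
    h.isSeparated, ?_, ?_⟩
  · exact MorphismProperty.of_pullback_snd_of_descendsAlong
      (Q := @Surjective ⊓ @Flat ⊓ @QuasiCompact)
      (g := Spec.map (CommRingCat.ofHom i)) ⟨⟨hs, hf⟩, inferInstance⟩ h.locallyOfFiniteType
  · have h₁ : CompactSpace (pullback V.hom (Spec.map (CommRingCat.ofHom i)) : Scheme.{u}) :=
      (quasiCompact_iff_compactSpace (f := pullback.snd V.hom _)).1 h.quasiCompact
    have h₂ : Surjective (pullback.fst V.hom (Spec.map (CommRingCat.ofHom i))) := inferInstance
    rw [quasiCompact_iff_compactSpace]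
    exact h₂.surj.compactSpace (Scheme.Hom.continuous _)

lemma IsAlgebraicScheme.conjProd {k K Ω : Type u} [Field k] [Field K] [Field Ω] [Algebra k K]
    [Algebra k Ω] [FiniteDimensional k K] {V : Over (Spec (CommRingCat.of K))}
    (hV : IsAlgebraicScheme V) : IsAlgebraicScheme (conjProd k Ω V) :=
  IsAlgebraicScheme.pi (f := fun τ : K →ₐ[k] Ω ↦ (WeilRes.baseChange τ.toRingHom).obj V)
    fun τ ↦ hV.baseChange τ.toRingHom

theorem IsRepresenting.isAlgebraicScheme {k K : Type u} [Field k] [Field K] [Algebra k K]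
    [FiniteDimensional k K] [Algebra.IsSeparable k K] {V : Over (Spec (CommRingCat.of K))}
    {W : Over (Spec (CommRingCat.of k))} {φ : (WeilRes.baseChange (algebraMap k K)).obj W ⟶ V}
    (h : IsRepresenting V W φ) (hV : IsAlgebraicScheme V) : IsAlgebraicScheme W := by
  -- The comparison needs only that minimal polynomials split, so an algebraic closure serves even
  -- if it is not Galois over `k`.
  have := isIso_toConjProd (Ω := AlgebraicClosure K) h fun x ↦ IsAlgClosed.splits _
  exact .of_baseChange _ (hV.conjProd.of_iso (asIso (toConjProd (AlgebraicClosure K) φ)).symm)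

end

end WeilRes

theorem proposition7p1 {k K : Type u} [Field k] [Field K] [Algebra k K]
    [FiniteDimensional k K] [Algebra.IsSeparable k K]
    (V : Over (Spec (CommRingCat.of K)))
    (hV : WeilRes.IsAlgebraicVariety V) (hqp : WeilRes.IsQuasiProjective V) :
    ∃ (W : Over (Spec (CommRingCat.of k)))
      (φ : (WeilRes.baseChange (algebraMap k K)).obj W ⟶ V),
      WeilRes.IsWeilRestriction V W φ ∧
      ∀ (Ω : Type u) [Field Ω] [Algebra k Ω] [IsGalois k Ω],
        (∀ x : K, ((minpoly k x).map (algebraMap k Ω)).Splits) →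
        WeilRes.IsDescentSystem (k := k) (WeilRes.conjProd k Ω V)
          (WeilRes.conjProdDescent V) ∧
        ∃ m : WeilRes.conjProd k Ω V ≅ (WeilRes.baseChange (algebraMap k Ω)).obj W,
          WeilRes.IsSplitBy (WeilRes.conjProd k Ω V) (WeilRes.conjProdDescent V) W m ∧
          ∀ τ : K →ₐ[k] Ω,
            (WeilRes.baseChangeComp (algebraMap k K) τ.toRingHom (algebraMap k Ω)
                τ.comp_algebraMap W).hom ≫ m.inv ≫ WeilRes.conjProdπ V τ =
              (WeilRes.baseChange τ.toRingHom).map φ := by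
  obtain ⟨W, φ, h⟩ := WeilRes.exists_isRepresenting (k := k) V hqp
  refine ⟨W, φ, ⟨h.isAlgebraicScheme hV.toIsAlgebraicScheme, fun T _ φ' ↦ h T φ'⟩,
    fun Ω _ _ _ hΩ ↦ ?_⟩
  have := WeilRes.isIso_toConjProd (k := k) h hΩ
  -- Here `m` is the inverse of the comparison map, so `m.inv` has components `τφ` by construction.
  have hm := WeilRes.isSplitBy_toConjProd (Ω := Ω) (φ := φ)
    (m := (asIso (WeilRes.toConjProd Ω φ)).symm) rfl
  refine ⟨hm.isDescentSystem, _, hm, fun τ ↦ ?_⟩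
  refine (congrArg _ (WeilRes.toConjProd_π φ τ)).trans ?_
  exact Iso.hom_inv_id_assoc _ _
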